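/- Consider generalized indefinite strings $(L,\omega,\upsilon)$ with $L=\infty$, i.e. $\omega$ is a real-valued distribution in $H^{-1}_{\mathrm{loc}}[0,\infty)$ (the dual of $H^1_{\mathrm c}[0,\infty)$) with normalized anti-derivative $\mathsf w\in L^2_{\mathrm{loc}}[0,\infty)$, so that $\omega(h)=-\int_0^\infty \mathsf w(x)h'(x)\,dx$ for $h\in H^1_{\mathrm c}[0,\infty)$, and $\upsilon$ is a non-negative Borel measure on $[0,\infty)$, finite on compact sets. Such a string belongs to the class $\mathcal F_0$ if there is $R>0$ such that $\mathsf w(x)=x$ for almost all $x\ge R$, $\upsilon$ vanishes on $[R,\infty)$, $\mathsf w$ is equal almost everywhere on $[0,R]$ to a piecewise constant function, and the support of $\upsilon$ is a finite set. A solution of $-f''=z\,\omega f+z^2\upsilon f$ is a function $f\in H^1_{\mathrm{loc}}[0,\infty)$ such that for some constant, denoted by $f'(0-)$, one has $f'(0-)h(0)+\int_0^\infty f'(x)h'(x)\,dx=z\,\omega(fh)+z^2\int_{[0,\infty)}fh\,d\upsilon$ for all $h\in H^1_{\mathrm c}[0,\infty)$. For $k$ in the open upper half-plane $\mathbb C_+$,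 the Jost solution $f(k,\cdot)$ is the solution with $z=k^2$ such that $f(k,x)=e^{ikx}$ for all $x\ge R$, and $$a(k)=\frac{ik f(k,0)+f'(k,0-)}{2ik},\qquad k\in\mathbb C_+ .$$ **Lemma.** Let $(\infty,\omega,\upsilon)\in\mathcal F_0$. Then the Jost solutions exist, $a$ is well defined and extends uniquely to an entire function (again denoted by $a$), and $a$ has only finitely many zeros in $\mathbb C_+$, all of them on the imaginary axis. If $i\kappa_1,\dots,i\kappa_N$ (with $\kappa_n>0$) denote these zeros, repeated according to multiplicity, then $$\frac43\sum_{n=1}^N\frac1{\kappa_n^3}+\frac2\pi\int_{\mathbb R}\frac{1}{k^4}\log|a(k)|\,dk=\int_0^\infty|\mathsf w(x)-x|^2\,dx+\int_{[0,\infty)}d\upsilon ,$$ where all integrals are finite (the one over $\mathbb R$ converges absolutely). -/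

import Mathlib

open MeasureTheory Set

namespace IndefString

/-- The Sobolev space `H¹_loc[0,∞)`: locally absolutely continuous functions on `[0,∞)` with locally
square integrable derivative. Functions on `[0,∞)` are represented by functions on `ℝ` whose values
on `(-∞,0)` are irrelevant. -/
def MemH1loc (f : ℝ → ℂ) : Prop :=
  (∀ b : ℝ, 0 < b → AbsolutelyContinuousOnInterval f 0 b) ∧
    ∀ b : ℝ, 0 < b → MemLp (deriv f) 2 (volume.restrict (Ioo 0 b))

/-- The Sobolev space `H¹[0,∞)`. -/
def MemH1 (f : ℝ → ℂ) : Prop :=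
  MemH1loc f ∧ MemLp f 2 (volume.restrict (Ioi 0)) ∧ MemLp (deriv f) 2 (volume.restrict (Ioi 0))

/-- The space `H¹_c[0,∞)` of functions in `H¹[0,∞)` with compact support in `[0,∞)`. -/
def MemH1c (f : ℝ → ℂ) : Prop :=
  MemH1 f ∧ ∃ b : ℝ, ∀ x : ℝ, b ≤ x → f x = 0

/-- A generalized indefinite string `(L, ω, υ)` of infinite length `L = ∞`. The real-valued
distribution `ω` in `H⁻¹_loc[0,∞)`, the topological dual of `H¹_c[0,∞)`, is given through its
normalized anti-derivative `w`, a real-valued function in `L²_loc[0,∞)`; see `GenString.omega`.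
The non-negative Borel measure `υ` on `[0,∞)` is a measure on `ℝ` with no mass on `(-∞,0)`. -/
structure GenString where
  /-- the normalized anti-derivative of `ω` -/
  w : ℝ → ℝ
  w_memLp : ∀ b : ℝ, 0 < b → MemLp w 2 (volume.restrict (Ioo 0 b))
  /-- the measure coefficient -/
  υ : Measure ℝ
  υ_neg : υ (Iio 0) = 0
  υ_locallyFinite : IsLocallyFiniteMeasure υ

/-- The distribution `ω`, that is, the functional `h ↦ - ∫₀^∞ w(x) h'(x) dx` on `H¹_c[0,∞)`. -/
noncomputable def GenString.omega (S : GenString) (h : ℝ → ℂ) : ℂ :=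
  -∫ x in Ioi (0 : ℝ), (S.w x : ℂ) * deriv h x

/-- The function `f` is a (weak) solution of `-f'' = z ω f + z² υ f` on `[0,∞)`
with `f'(0-) = d`. -/
def GenString.IsSolution (S : GenString) (z : ℂ) (f : ℝ → ℂ) (d : ℂ) : Prop :=
  MemH1loc f ∧ ∀ h : ℝ → ℂ, MemH1c h →
    d * h 0 + ∫ x in Ioi (0 : ℝ), deriv f x * deriv h x =
      z * S.omega (fun x => f x * h x) + z ^ 2 * ∫ x in Ici (0 : ℝ), f x * h x ∂S.υ

/-- The function `w` is equal almost everywhere on `[0,R]` to a piecewise constant function (with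
finitely many pieces). -/
def AEPiecewiseConst (w : ℝ → ℝ) (R : ℝ) : Prop :=
  ∃ (n : ℕ) (t : Fin (n + 1) → ℝ) (c : Fin n → ℝ),
    StrictMono t ∧ t 0 = 0 ∧ t (Fin.last n) = R ∧
      ∀ j : Fin n, ∀ᵐ x ∂(volume.restrict (Ioo (t j.castSucc) (t j.succ))), w x = c j

/-- The string `S` belongs to the class `F₀`, with the number `R > 0` as a witness. -/
structure GenString.MemF0 (S : GenString) (R : ℝ) : Prop where
  R_pos : 0 < R
  w_eq : ∀ᵐ x ∂(volume.restrict (Ici R)), S.w x = x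
  υ_eq : S.υ (Ici R) = 0
  w_piecewise : AEPiecewiseConst S.w R
  υ_support : S.υ.support.Finite

/-- The function `f` is a Jost solution: it solves the differential equation with `z = k²`, has
`f'(0-) = d` and satisfies `f(x) = exp(ikx)` for `x ≥ R`. -/
def GenString.IsJost (S : GenString) (R : ℝ) (k : ℂ) (f : ℝ → ℂ) (d : ℂ) : Prop :=
  S.IsSolution (k ^ 2) f d ∧ ∀ x : ℝ, R ≤ x → f x = Complex.exp (Complex.I * k * x)

/-- The function `a` is the reciprocal transmission coefficient: an entire function such that
`a(k) = (i k f(k,0) + f'(k,0-)) / (2 i k)` for `k` in the upper half-plane, where `f(k,·)` is the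
Jost solution (which exists). -/
def GenString.IsReciprocalTransmission (S : GenString) (R : ℝ) (a : ℂ → ℂ) : Prop :=
  Differentiable ℂ a ∧ ∀ k : ℂ, 0 < k.im →
    (∃ (f : ℝ → ℂ) (d : ℂ), S.IsJost R k f d) ∧
      ∀ (f : ℝ → ℂ) (d : ℂ), S.IsJost R k f d →
        a k = (Complex.I * k * f 0 + d) / (2 * Complex.I * k)

/-- The numbers `iκ₁, …, iκ_N` with positive `κ₁, …, κ_N` are precisely the zeros of the analytic
function `a` in the upper half-plane, repeated according to their multiplicities. -/
def IsZeroEnumeration (a : ℂ → ℂ) {N : ℕ} (κ : Fin N → ℝ) : Prop :=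
  (∀ n, 0 < κ n) ∧
    ∀ k : ℂ, 0 < k.im → analyticOrderAt a k = {n : Fin N | Complex.I * (κ n : ℂ) = k}.encard

end IndefString

/-! Put s = ik, so that z = k² = -s². Where w is constant and υ vanishes, solutions are affine, so
the pair (f, f' + z w f) is carried from right to left by explicit maps that are polynomial in s
(`transfer`); for x ≥ R the Jost pair is e^{sx}(1, s - s²x). Hence a(k) = e^{ikR} p(ik) for a real
polynomial p (`GenString.IsJost.eq`, `aeval_transmission`). By `exists_transmission_polynomial`,
p(s) = 1 - Rs + R²s²/2 + (W/2 - R³/6)s³ + O(s⁴), where W is the right-hand side of the trace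
formula. Equivalently, log(e^{Rs} p(s)) = Ws³/2 + O(s⁴).

Write p(s) = ∏(1 - ρs). Comparing coefficients gives ∑ρ² = 0 and ∑ρ³ = -3W/2
(`power_sums_of_expansion`). An energy identity (`transfer_energy`, `transfer_root`) shows that
every ρ with Re ρ ≤ 0 is real and negative; these ρ = -1/κ are exactly the ones that give zeros iκ
of a in the upper half-plane.

On the real line |a(t)| = |p(it)| is even, and pairing t with -t turns each linear factor into 1 +
ρ²t². The integral over (0,∞) of (log(1 + ρ²t²) - ρ²t²)/t⁴ is -πρ³/3 for Re ρ > 0, and the sign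
flips for Re ρ < 0. The subtracted terms cancel in the sum because ∑ρ² = 0. The integral of
log|a|/t⁴ is therefore -(π/3) times ∑ρ³ with the sign reversed on the negative ρ, and this reversal
produces the sum over κ. -/

/-! ### The regularized logarithmic integral of a quadratic factor. -/

lemma norm_log_one_add_mul_sq_sub_le {c : ℂ} {t : ℝ} (ht : ‖c‖ * t ^ 2 < 1 / 2) :
    ‖Complex.log (1 + c * (t : ℂ) ^ 2) - c * (t : ℂ) ^ 2‖ ≤ ‖c‖ ^ 2 * t ^ 4 := by
  have hn : ‖c * (t : ℂ) ^ 2‖ = ‖c‖ * t ^ 2 := by simp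
  have h2 := Complex.norm_log_one_add_sub_self_le (z := c * (t : ℂ) ^ 2) (by rw [hn]; linarith)
  refine h2.trans ?_
  rw [hn]
  have h3 : (1 - ‖c‖ * t ^ 2)⁻¹ ≤ 2 := by
    rw [inv_le_comm₀ (by linarith) (by norm_num)]; linarith
  calc _ ≤ (‖c‖ * t ^ 2) ^ 2 * 2 / 2 := by gcongr
    _ = _ := by ring

open Filter Topology in
lemma eventually_norm_mul_sq_lt (c : ℂ) : ∀ᶠ t : ℝ in 𝓝 0, ‖c‖ * t ^ 2 < 1 / 2 := by
  have : Tendsto (fun t : ℝ => ‖c‖ * t ^ 2) (𝓝 0) (𝓝 (‖c‖ * 0 ^ 2)) :=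
    Continuous.tendsto (by fun_prop) _
  exact this.eventually (gt_mem_nhds (by norm_num))

open Filter Topology Asymptotics in
lemma isBigO_log_one_add_mul_sq {c : ℂ} (hc : c ≠ 0) :
    (fun t : ℝ => Complex.log (1 + c * (t : ℂ) ^ 2) - c * (t : ℂ) ^ 2) =O[atTop]
      (fun t : ℝ => t ^ 2) := by
  have hc0 : 0 < ‖c‖ := norm_pos_iff.mpr hc
  refine IsBigO.of_bound (1 + Real.pi + ‖c‖ + ‖c‖) ?_
  filter_upwards [eventually_ge_atTop (1 : ℝ),
    (tendsto_pow_atTop (two_ne_zero) : Tendsto (fun t : ℝ => t ^ 2) atTop atTop).eventually_ge_atTop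
      (2 / ‖c‖)] with t ht1 ht2
  have h1 : 2 ≤ ‖c‖ * t ^ 2 := by
    rw [div_le_iff₀ hc0] at ht2; linarith
  have hn : ‖c * (t : ℂ) ^ 2‖ = ‖c‖ * t ^ 2 := by
    simp
  have hlow : 1 ≤ ‖1 + c * (t : ℂ) ^ 2‖ := by
    have := norm_sub_norm_le (c * (t : ℂ) ^ 2) (-1)
    rw [norm_neg, norm_one, hn, sub_neg_eq_add, add_comm (c * (t : ℂ) ^ 2)] at this
    linarith
  have hup : ‖1 + c * (t : ℂ) ^ 2‖ ≤ 1 + ‖c‖ * t ^ 2 := by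
    have := norm_add_le 1 (c * (t : ℂ) ^ 2)
    rwa [norm_one, hn] at this
  have hlog : ‖Complex.log (1 + c * (t : ℂ) ^ 2)‖ ≤ 1 + ‖c‖ * t ^ 2 + Real.pi := by
    refine (Complex.norm_le_abs_re_add_abs_im _).trans ?_
    rw [Complex.log_re, Complex.log_im]
    refine add_le_add ?_ (Complex.abs_arg_le_pi _)
    rw [abs_of_nonneg (Real.log_nonneg hlow)]
    exact ((Real.log_le_sub_one_of_pos (by linarith)).trans (by linarith)).trans hup
  rw [Real.norm_of_nonneg (by positivity)]
  refine (norm_sub_le _ _).trans ?_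
  rw [hn]
  have : 1 ≤ t ^ 2 := by nlinarith
  nlinarith [Real.pi_pos]

open Filter Topology Asymptotics in
lemma integrableOn_log_one_add_mul_sq {c : ℂ} (hc : c ≠ 0)
    (hs : ∀ t : ℝ, 1 + c * (t : ℂ) ^ 2 ∈ Complex.slitPlane) :
    IntegrableOn (fun t : ℝ => (Complex.log (1 + c * (t : ℂ) ^ 2) - c * (t : ℂ) ^ 2) / (t : ℂ) ^ 4)
      (Ioi 0) := by
  have hcont : Continuous
      (fun t : ℝ => Complex.log (1 + c * (t : ℂ) ^ 2) - c * (t : ℂ) ^ 2) := by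
    refine Continuous.sub (Continuous.clog (by fun_prop) hs) (by fun_prop)
  have key : MellinConvergent
      (fun t : ℝ => Complex.log (1 + c * (t : ℂ) ^ 2) - c * (t : ℂ) ^ 2) (-3 : ℂ) := by
    -- The weight t^(-4) is the Mellin kernel t^(s-1) at s = -3, which lies strictly between the
    -- exponents -4 (size t⁴ at zero) and -2 (size t² at infinity).
    refine mellinConvergent_of_isBigO_rpow (a := -2) (b := -4)
      (hcont.locallyIntegrable.locallyIntegrableOn _) ?_ (by norm_num) ?_ (by norm_num)
    · simpa using isBigO_log_one_add_mul_sq hc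
    · refine IsBigO.of_bound (‖c‖ ^ 2) ?_
      filter_upwards [nhdsWithin_le_nhds (eventually_norm_mul_sq_lt c)] with t ht
      have ht' : (t ^ (-(-4) : ℝ)) = t ^ 4 := by norm_num
      rw [ht', Real.norm_of_nonneg (by positivity)]
      exact norm_log_one_add_mul_sq_sub_le ht
  refine (integrableOn_congr_fun ?_ measurableSet_Ioi).mp key
  intro t ht
  have : ((t : ℂ) ^ ((-3 : ℂ) - 1)) = ((t : ℂ) ^ 4)⁻¹ := by
    rw [show (-3 : ℂ) - 1 = ((-4 : ℤ) : ℂ) by norm_num, Complex.cpow_intCast]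
    norm_cast
  simp only [this, smul_eq_mul]
  rw [div_eq_inv_mul]

/-- A value in (-∞, 0] would force ρt to be purely imaginary and nonzero. -/
lemma one_add_mul_sq_mem_slitPlane {ρ : ℂ} (hρ : ρ.re ≠ 0) (t : ℝ) :
    1 + ρ ^ 2 * (t : ℂ) ^ 2 ∈ Complex.slitPlane := by
  rw [Complex.mem_slitPlane_iff]
  by_cases h : ρ.im * t = 0
  · left
    have : (1 + ρ ^ 2 * (t : ℂ) ^ 2).re = 1 + (ρ.re * t) ^ 2 - (ρ.im * t) ^ 2 := by
      simp [sq]; ring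
    rw [this, h]; nlinarith [sq_nonneg (ρ.re * t)]
  · right
    have : (1 + ρ ^ 2 * (t : ℂ) ^ 2).im = 2 * ρ.re * (ρ.im * t) * t := by
      simp [sq]; ring
    rw [this]
    have : t ≠ 0 := fun h0 => h (by simp [h0])
    exact mul_ne_zero (mul_ne_zero (mul_ne_zero two_ne_zero hρ) h) this

open Filter Topology Asymptotics in
lemma integral_log_one_add_mul_sq {ρ : ℂ} (hρ : 0 < ρ.re) :
    ∫ t in Ioi (0 : ℝ), (Complex.log (1 + ρ ^ 2 * (t : ℂ) ^ 2) - ρ ^ 2 * (t : ℂ) ^ 2) / (t : ℂ) ^ 4 =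
      -(Real.pi / 3) * ρ ^ 3 := by
  have hρ0 : ρ ≠ 0 := fun h => by simp [h] at hρ
  have hslit := one_add_mul_sq_mem_slitPlane hρ.ne'
  have hint := integrableOn_log_one_add_mul_sq (pow_ne_zero 2 hρ0) hslit
  have hslit1 : ∀ t : ℝ, 1 + Complex.I * ρ * t ∈ Complex.slitPlane := by
    intro t
    rw [Complex.mem_slitPlane_iff]
    rcases eq_or_ne t 0 with rfl | ht
    · left; simp
    · right; simp [ht, hρ.ne']
  have hslit2 : ∀ t : ℝ, 1 - Complex.I * ρ * t ∈ Complex.slitPlane := by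
    intro t
    have := hslit1 (-t)
    push_cast at this
    rwa [mul_neg, ← sub_eq_add_neg] at this
  set h : ℝ → ℂ := fun t => Complex.log (1 + ρ ^ 2 * (t : ℂ) ^ 2) - ρ ^ 2 * (t : ℂ) ^ 2 with hdef
  set D : ℝ → ℂ := fun t => Complex.log (1 + Complex.I * ρ * t) - Complex.log (1 - Complex.I * ρ * t)
    with hD
  -- An antiderivative from integration by parts: the remaining integrand is a multiple of 1/(1 +
  -- ρ²t²), and D plays the role of 2i·arctan(ρt).
  set H : ℝ → ℂ := fun t => -(1 / 3) * (h t / (t : ℂ) ^ 3) - ρ ^ 3 / (3 * Complex.I) * D t with hH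
  have hprod : ∀ t : ℝ, (1 + Complex.I * ρ * t) * (1 - Complex.I * ρ * t) = 1 + ρ ^ 2 * (t : ℂ) ^ 2 := by
    intro t; linear_combination (-(ρ ^ 2 * (t : ℂ) ^ 2)) * Complex.I_sq
  have hderiv : ∀ t ∈ Ioi (0 : ℝ), HasDerivAt H (h t / (t : ℂ) ^ 4) t := by
    intro t ht
    have ht0 : (t : ℂ) ≠ 0 := by exact_mod_cast (ne_of_gt ht)
    have hof : HasDerivAt (fun t : ℝ => (t : ℂ)) 1 t := Complex.ofRealCLM.hasDerivAt
    have n0 := Complex.slitPlane_ne_zero (hslit t)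
    have n1 := Complex.slitPlane_ne_zero (hslit1 t)
    have n2 := Complex.slitPlane_ne_zero (hslit2 t)
    have e0 : HasDerivAt (fun t : ℝ => ρ ^ 2 * (t : ℂ) ^ 2) (ρ ^ 2 * (2 * t)) t := by
      have := (hof.pow 2).const_mul (ρ ^ 2); simpa using! this
    have e1 : HasDerivAt (fun t : ℝ => Complex.I * ρ * (t : ℂ)) (Complex.I * ρ) t := by
      have := hof.const_mul (Complex.I * ρ); simpa using this
    have e3 : HasDerivAt (fun t : ℝ => (t : ℂ) ^ 3) (3 * (t : ℂ) ^ 2) t := by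
      have := hof.pow 3; simpa using! this
    have d1 := (e0.const_add 1).clog_real (hslit t)
    have d2 := (e1.const_add 1).clog_real (hslit1 t)
    have d3 := (e1.const_sub 1).clog_real (hslit2 t)
    have := (((d1.sub e0).div e3 (pow_ne_zero 3 ht0)).const_mul (-(1 / 3 : ℂ))).sub
      ((d2.sub d3).const_mul (ρ ^ 3 / (3 * Complex.I)))
    refine this.congr_deriv ?_
    simp only [hdef, Pi.sub_apply]
    rw [← hprod t] at n0 ⊢
    have hd : Complex.I * ρ / (1 + Complex.I * ρ * t) - -(Complex.I * ρ) / (1 - Complex.I * ρ * t) =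
        2 * Complex.I * ρ / ((1 + Complex.I * ρ * t) * (1 - Complex.I * ρ * t)) := by
      field_simp; ring
    rw [hd, hprod t]
    rw [hprod t] at n0
    field_simp
    ring
  have hcont : ContinuousWithinAt H (Ici 0) 0 := by
    refine ContinuousAt.continuousWithinAt ?_
    refine ContinuousAt.sub (ContinuousAt.mul continuousAt_const ?_)
      (ContinuousAt.mul continuousAt_const ?_)
    · rw [ContinuousAt]
      -- The value 0 from division by zero is the true limit, since h = O(t⁴).
      have hz : h 0 / ((0 : ℝ) : ℂ) ^ 3 = 0 := by simp
      rw [hz]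
      refine squeeze_zero_norm' (a := fun t : ℝ => ‖ρ ^ 2‖ ^ 2 * |t|) ?_ ?_
      · filter_upwards [eventually_norm_mul_sq_lt (ρ ^ 2)] with t ht
        rw [norm_div, norm_pow, Complex.norm_real, Real.norm_eq_abs]
        refine div_le_of_le_mul₀ (by positivity) (by positivity) ?_
        calc ‖h t‖ ≤ _ := norm_log_one_add_mul_sq_sub_le ht
          _ = _ := by rw [mul_assoc, ← pow_succ', (by decide : Even 4).pow_abs]
      · exact (Continuous.tendsto' (by fun_prop) _ _ (by simp))
    · exact (Continuous.sub (Continuous.clog (by fun_prop) hslit1)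
        (Continuous.clog (by fun_prop) hslit2)).continuousAt
  have hlim : Tendsto H atTop (𝓝 (-(Real.pi / 3) * ρ ^ 3)) := by
    have h1 : Tendsto (fun t : ℝ => h t / (t : ℂ) ^ 3) atTop (𝓝 0) := by
      obtain ⟨C, hC⟩ := (isBigO_log_one_add_mul_sq (pow_ne_zero 2 hρ0)).bound
      refine squeeze_zero_norm' (a := fun t : ℝ => C * t⁻¹) ?_ ?_
      · filter_upwards [hC, eventually_gt_atTop 0] with t ht ht0
        rw [norm_div, norm_pow, Complex.norm_real, Real.norm_of_nonneg ht0.le,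
          div_le_iff₀ (by positivity)]
        refine ht.trans (le_of_eq ?_)
        rw [Real.norm_of_nonneg (by positivity)]
        field_simp
      · simpa using tendsto_inv_atTop_zero.const_mul C
    have h2 : Tendsto D atTop (𝓝 (Complex.I * Real.pi)) := by
      have him : 0 < (Complex.I * ρ).im := by simpa using hρ
      have hs1 : Complex.I * ρ ∈ Complex.slitPlane := Or.inr him.ne'
      have hs2 : -(Complex.I * ρ) ∈ Complex.slitPlane := Or.inr (by rw [Complex.neg_im]; linarith)
      have hval : Complex.I * Real.pi = Complex.log (Complex.I * ρ) - Complex.log (-(Complex.I * ρ)) := by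
        rw [Complex.log, Complex.log, norm_neg, Complex.arg_neg_eq_arg_sub_pi_of_im_pos him]
        push_cast; ring
      have hinv : Tendsto (fun t : ℝ => ((t⁻¹ : ℝ) : ℂ)) atTop (𝓝 0) := by
        have := (Complex.continuous_ofReal.tendsto 0).comp (tendsto_inv_atTop_zero (𝕜 := ℝ))
        rw [Complex.ofReal_zero] at this
        exact this
      -- Factoring the positive number t out of both logarithms contributes log t twice, and these
      -- cancel in D; the limit is then a jump of iπ between opposite arguments.
      have l1 : Tendsto (fun t : ℝ => Complex.log (((t⁻¹ : ℝ) : ℂ) + Complex.I * ρ)) atTop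
          (𝓝 (Complex.log (Complex.I * ρ))) := by
        refine Tendsto.clog ?_ hs1
        simpa using hinv.add_const (Complex.I * ρ)
      have l2 : Tendsto (fun t : ℝ => Complex.log (((t⁻¹ : ℝ) : ℂ) - Complex.I * ρ)) atTop
          (𝓝 (Complex.log (-(Complex.I * ρ)))) := by
        refine Tendsto.clog ?_ hs2
        simpa using hinv.sub_const (Complex.I * ρ)
      rw [hval]
      refine (l1.sub l2).congr' ?_
      filter_upwards [eventually_gt_atTop 0] with t ht
      have ht0 : (t : ℂ) ≠ 0 := by exact_mod_cast ht.ne'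
      have e1 : 1 + Complex.I * ρ * t = (t : ℂ) * (((t⁻¹ : ℝ) : ℂ) + Complex.I * ρ) := by
        push_cast; field_simp
      have e2 : 1 - Complex.I * ρ * t = (t : ℂ) * (((t⁻¹ : ℝ) : ℂ) - Complex.I * ρ) := by
        push_cast; field_simp
      have n1 : ((t⁻¹ : ℝ) : ℂ) + Complex.I * ρ ≠ 0 := fun h0 =>
        Complex.slitPlane_ne_zero (hslit1 t) (by rw [e1, h0, mul_zero])
      have n2 : ((t⁻¹ : ℝ) : ℂ) - Complex.I * ρ ≠ 0 := fun h0 =>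
        Complex.slitPlane_ne_zero (hslit2 t) (by rw [e2, h0, mul_zero])
      simp only [hD]
      rw [e1, e2, Complex.log_ofReal_mul ht n1, Complex.log_ofReal_mul ht n2]
      ring
    have := (h1.const_mul (-(1 / 3 : ℂ))).sub (h2.const_mul (ρ ^ 3 / (3 * Complex.I)))
    convert this using 2
    field_simp [Complex.I_ne_zero]
    ring
  have h0 : H 0 = 0 := by simp [hH, hdef, hD]
  rw [integral_Ioi_of_hasDerivAt_of_tendsto hcont hderiv hint hlim, h0, sub_zero]

/-- The regularized logarithmic integral of a linear factor `1 - ρ i t` and its reflection. -/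
lemma integral_log_norm_one_add_mul_sq {ρ : ℂ} (hρ : ρ.re ≠ 0) :
    IntegrableOn (fun t : ℝ => (Real.log ‖1 + ρ ^ 2 * (t : ℂ) ^ 2‖ - (ρ ^ 2).re * t ^ 2) / t ^ 4)
      (Ioi 0) ∧
    ∫ t in Ioi (0 : ℝ), (Real.log ‖1 + ρ ^ 2 * (t : ℂ) ^ 2‖ - (ρ ^ 2).re * t ^ 2) / t ^ 4 =
      -(Real.pi / 3) * (if 0 < ρ.re then (ρ ^ 3).re else -(ρ ^ 3).re) := by
  have hρ0 : ρ ≠ 0 := fun h => by simp [h] at hρ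
  have hint := integrableOn_log_one_add_mul_sq (pow_ne_zero 2 hρ0)
    (one_add_mul_sq_mem_slitPlane hρ)
  have hre : ∀ t : ℝ, ((Complex.log (1 + ρ ^ 2 * (t : ℂ) ^ 2) - ρ ^ 2 * (t : ℂ) ^ 2) /
      (t : ℂ) ^ 4).re = (Real.log ‖1 + ρ ^ 2 * (t : ℂ) ^ 2‖ - (ρ ^ 2).re * t ^ 2) / t ^ 4 := by
    intro t
    have h4 : (t : ℂ) ^ 4 = ((t ^ 4 : ℝ) : ℂ) := by push_cast; rfl
    have h2 : (t : ℂ) ^ 2 = ((t ^ 2 : ℝ) : ℂ) := by push_cast; rfl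
    rw [h4, Complex.div_ofReal_re, Complex.sub_re, Complex.log_re, h2, Complex.re_mul_ofReal]
  have hint' := hint.re
  have hval := integral_re hint
  simp only [RCLike.re_to_complex, hre] at hint' hval
  refine ⟨hint', hval.trans ?_⟩
  split_ifs with hpos
  · rw [integral_log_one_add_mul_sq hpos]
    have : (-(Real.pi / 3 : ℂ)) = ((-(Real.pi / 3) : ℝ) : ℂ) := by push_cast; rfl
    rw [this, Complex.re_ofReal_mul]
  · have hneg : 0 < (-ρ).re := by
      rw [Complex.neg_re]; have := lt_of_le_of_ne (not_lt.mp hpos) hρ; linarith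
    have := integral_log_one_add_mul_sq hneg
    rw [neg_sq] at this
    rw [this]
    have : (-(Real.pi / 3 : ℂ)) = ((-(Real.pi / 3) : ℝ) : ℂ) := by push_cast; rfl
    rw [this, Complex.re_ofReal_mul]
    simp [pow_succ]

/-! ### Algebra of the transfer recursion. -/

namespace IndefString

/-- One step of `transfer`: the data `(f, f' + z w f)` at the left end of an interval of length `l`
on which `w = c`, with a point mass `v` at its left end, in terms of the data at the right end. -/
def transferStep {A : Type*} [CommRing A] [Algebra ℝ A] (z : A) (l c v : ℝ) (p : A × A) : A × A :=
  let m := p.2 - z * algebraMap ℝ A c * p.1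
  let f := p.1 - algebraMap ℝ A l * m
  (f, m + z * algebraMap ℝ A c * f + z ^ 2 * algebraMap ℝ A v * f)

/-- The data at the left end of a chain of intervals, described by a list of triples of length,
value of `w` and point mass at the left end, in terms of the data at the right end. -/
def transfer {A : Type*} [CommRing A] [Algebra ℝ A] (z : A) : List (ℝ × ℝ × ℝ) → A × A → A × A
  | [], p => p
  | (l, c, v) :: L, p => transferStep z l c v (transfer z L p)

/-- The value of `∫ |w - x|² dx + ∫ dυ` over a chain of intervals that begins at `x`. -/
noncomputable def weight : ℝ → List (ℝ × ℝ × ℝ) → ℝ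
  | _, [] => 0
  | x, (l, c, v) :: L => ((c - x) ^ 3 - (c - x - l) ^ 3) / 3 + v + weight (x + l) L

/-- Lets one recursion be read both in ℝ[X], where low-order coefficients are computed, and in ℂ,
where solutions live. -/
lemma map_transfer {A B : Type*} [CommRing A] [Algebra ℝ A] [CommRing B] [Algebra ℝ B]
    (φ : A →ₐ[ℝ] B) (z : A) (L : List (ℝ × ℝ × ℝ)) (p : A × A) :
    transfer (φ z) L (φ p.1, φ p.2) = (φ (transfer z L p).1, φ (transfer z L p).2) := by
  induction L with
  | nil => rfl
  | cons t L ih =>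
    obtain ⟨l, c, v⟩ := t
    simp [transfer, ih, transferStep, AlgHom.commutes]

/-- Each step is a composition of shears and so has determinant one. -/
lemma transfer_wronskian {A : Type*} [CommRing A] [Algebra ℝ A] (z : A) (L : List (ℝ × ℝ × ℝ))
    (p q : A × A) : (transfer z L p).1 * (transfer z L q).2 - (transfer z L p).2 * (transfer z L q).1
      = p.1 * q.2 - p.2 * q.1 := by
  induction L with
  | nil => rfl
  | cons t L ih =>
    obtain ⟨l, c, v⟩ := t
    rw [← ih]
    simp only [transfer, transferStep]
    ring

-- The equation tested against the conjugate of its own solution: A, B and C are the discrete forms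
-- of ∫|f'|², ∫w(|f|²)' and ∫|f|²dυ.
open ComplexConjugate in
lemma transfer_energy (z : ℂ) (L : List (ℝ × ℝ × ℝ)) (hL : ∀ t ∈ L, 0 < t.1 ∧ 0 ≤ t.2.2)
    (p : ℂ × ℂ) : ∃ A B C : ℝ, 0 ≤ A ∧ 0 ≤ C ∧
      conj p.1 * p.2 - conj (transfer z L p).1 * (transfer z L p).2 = A + z * B - z ^ 2 * C := by
  induction L with
  | nil => exact ⟨0, 0, 0, le_rfl, le_rfl, by simp [transfer]⟩
  | cons t L ih =>
    obtain ⟨l, c, v⟩ := t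
    obtain ⟨A, B, C, hA, hC, h⟩ := ih fun t ht => hL t (List.mem_cons_of_mem _ ht)
    obtain ⟨hl, hv⟩ := hL (l, c, v) List.mem_cons_self
    simp only [transfer]
    set q := transfer z L p
    set m := q.2 - z * c * q.1 with hm
    set f := q.1 - l * m with hf
    refine ⟨A + l * Complex.normSq m, B + c * (Complex.normSq q.1 - Complex.normSq f),
      C + v * Complex.normSq f, by positivity [Complex.normSq_nonneg m],
      by positivity [Complex.normSq_nonneg f], ?_⟩
    have h1 : transferStep z l c v q = (f, m + z * c * f + z ^ 2 * v * f) := rfl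
    have hcf : conj f = conj q.1 - l * conj m := by
      rw [hf, map_sub, map_mul, Complex.conj_ofReal]
    rw [h1]
    push_cast
    simp only [Complex.normSq_eq_conj_mul_self]
    have h2 : q.2 = m + z * c * q.1 := by rw [hm]; ring
    rw [h2] at h
    linear_combination h - m * hcf

/-- The energy identity becomes A - sE - s²(B - R) - s⁴C = 0 with E > 0. Only the coefficient of s²
has unknown sign; it drops out of the imaginary part after division by s², which leaves Im s times a
positive quantity when Re s ≤ 0. -/
lemma transfer_root {R : ℝ} {L : List (ℝ × ℝ × ℝ)} (hL : ∀ t ∈ L, 0 < t.1 ∧ 0 ≤ t.2.2)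
    {s : ℂ} (hs0 : s ≠ 0) (hs : s.re ≤ 0)
    (h : s * (transfer (-s ^ 2) L (1, s - s ^ 2 * R)).1 +
      (transfer (-s ^ 2) L (1, s - s ^ 2 * R)).2 = 0) : s.im = 0 ∧ s.re < 0 := by
  obtain ⟨A, B, C, hA, hC, hE⟩ := transfer_energy (-s ^ 2) L hL (1, s - s ^ 2 * R)
  set f := (transfer (-s ^ 2) L (1, s - s ^ 2 * R)).1
  set g := (transfer (-s ^ 2) L (1, s - s ^ 2 * R)).2
  have hg : g = -s * f := by linear_combination h
  rw [hg, map_one] at hE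
  set E : ℝ := 1 + Complex.normSq f with hEdef
  have hE0 : 0 < E := by positivity [Complex.normSq_nonneg f]
  have hn : 0 < Complex.normSq s := Complex.normSq_pos.mpr hs0
  have hns : Complex.normSq s = s.re ^ 2 + s.im ^ 2 := by rw [Complex.normSq_apply]; ring
  have him : s.im = 0 := by
    have key : (A : ℂ) - s * E - s ^ 2 * (B - R) - s ^ 4 * C = 0 := by
      rw [hEdef]; push_cast; rw [Complex.normSq_eq_conj_mul_self]
      linear_combination -hE
    have hre := congrArg Complex.re key
    have him := congrArg Complex.im key
    have e4 : s ^ 4 = s ^ 2 * s ^ 2 := by ring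
    rw [e4, sq] at hre him
    simp only [Complex.sub_re, Complex.sub_im, Complex.mul_re, Complex.mul_im, Complex.ofReal_re,
      Complex.ofReal_im, Complex.zero_re, Complex.zero_im] at hre him
    -- The imaginary part of `key` multiplied by the conjugate of s².
    have hcomb : s.im * (-(2 * s.re) * A + E * Complex.normSq s
        - 2 * s.re * C * Complex.normSq s ^ 2) = 0 := by
      rw [hns]
      linear_combination (-(2 * s.re * s.im)) * hre + (s.re ^ 2 - s.im ^ 2) * him
    rcases mul_eq_zero.mp hcomb with h0 | h0
    · exact h0
    · exfalso
      have h1 : 0 < E * Complex.normSq s := by positivity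
      have h2 : 0 ≤ -(2 * s.re) * A := mul_nonneg (by linarith) hA
      have h3 : 0 ≤ -(2 * s.re) * (C * Complex.normSq s ^ 2) :=
        mul_nonneg (by linarith) (by positivity)
      linarith
  refine ⟨him, lt_of_le_of_ne hs fun h0 => hs0 (Complex.ext h0 him)⟩

-- The numbers m₀ and m₁ stand for ∫w(t)dt and ∫(t - x)w(t)dt over [x, R]. The X⁴ coefficient of the
-- second component is ∫w² + ∫dυ - R∫w, rewritten through ∫(w - t)²; induction runs from R to the
-- left.
open Polynomial in
lemma transfer_expansion (R : ℝ) (L : List (ℝ × ℝ × ℝ)) (x : ℝ) (hR : x + (L.map Prod.fst).sum = R) :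
    ∃ (m₀ m₁ : ℝ) (q r : ℝ[X]),
      (transfer (-X ^ 2 : ℝ[X]) L (1, X - X ^ 2 * C R)).1 =
        1 - C (R - x) * X + C (R * (R - x) - m₀) * X ^ 2 + C ((R - x) * m₀ - 2 * m₁) * X ^ 3
          + X ^ 4 * q ∧
      (transfer (-X ^ 2 : ℝ[X]) L (1, X - X ^ 2 * C R)).2 =
        X - C R * X ^ 2 + C m₀ * X ^ 3
          + C (weight x L + 2 * (m₁ + x * m₀) - (R ^ 3 - x ^ 3) / 3 - R * m₀) * X ^ 4
          + X ^ 5 * r := by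
  induction L generalizing x with
  | nil =>
    refine ⟨0, 0, 0, 0, ?_⟩
    rw [List.map_nil, List.sum_nil, add_zero] at hR
    subst hR
    refine ⟨?_, ?_⟩
    · simp [transfer]
    · rw [show weight x [] = 0 from rfl]
      simp only [transfer, mul_zero, sub_self, map_zero, add_zero, zero_div, zero_mul]
      ring
  | cons t L ih =>
    obtain ⟨l, c, v⟩ := t
    obtain ⟨m₀, m₁, q, r, h1, h2⟩ := ih (x + l) (by simpa [add_assoc] using hR)
    set F := (transfer (-X ^ 2 : ℝ[X]) L (1, X - X ^ 2 * C R)).1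
    set G := (transfer (-X ^ 2 : ℝ[X]) L (1, X - X ^ 2 * C R)).2
    set α := weight (x + l) L + 2 * (m₁ + (x + l) * m₀) - (R ^ 3 - (x + l) ^ 3) / 3 - R * m₀ with hα
    set f₃ := (R - (x + l)) * m₀ - 2 * m₁ with hf₃
    have hβ : weight x ((l, c, v) :: L) + 2 * ((c * l ^ 2 / 2 + l * m₀ + m₁) + x * (c * l + m₀))
        - (R ^ 3 - x ^ 3) / 3 - R * (c * l + m₀) = α + l * c * (c - R) + v := by
      rw [hα, weight]; ring
    have hf : (R - x) * (c * l + m₀) - 2 * (c * l ^ 2 / 2 + l * m₀ + m₁) =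
        f₃ - l * (m₀ - c * (R - (x + l))) := by
      rw [hf₃]; ring
    -- The part of order at least four of G + X²cF, divided by X⁴; F is reduced by l times this sum.
    set M : ℝ[X] := C (α + c * (R * (R - (x + l)) - m₀)) + X * (r + C c * C f₃ + C c * X * q) with hM
    set q' : ℝ[X] := q - C l * M with hq'
    refine ⟨c * l + m₀, c * l ^ 2 / 2 + l * m₀ + m₁, q',
      (r + C c * C f₃ + C c * X * q) -
        C c * (C (f₃ - l * (m₀ - c * (R - (x + l)))) + X * q') +
        C v * (-C (R - x) + C (R * (R - x) - (c * l + m₀)) * X +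
          C (f₃ - l * (m₀ - c * (R - (x + l)))) * X ^ 2 + X ^ 3 * q'), ?_⟩
    rw [hβ, hf]
    have hstep : transfer (-X ^ 2 : ℝ[X]) ((l, c, v) :: L) (1, X - X ^ 2 * C R) =
      (F - C l * (G + X ^ 2 * C c * F), G + X ^ 2 * C c * F - X ^ 2 * C c *
        (F - C l * (G + X ^ 2 * C c * F)) + X ^ 4 * C v * (F - C l * (G + X ^ 2 * C c * F))) := by
      simp only [transfer, transferStep, Polynomial.algebraMap_eq]
      refine Prod.ext ?_ ?_ <;> simp only [F, G] <;> ring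
    rw [hstep]
    have hfst : F - C l * (G + X ^ 2 * C c * F) = 1 - C (R - x) * X +
        C (R * (R - x) - (c * l + m₀)) * X ^ 2 + C (f₃ - l * (m₀ - c * (R - (x + l)))) * X ^ 3 +
        X ^ 4 * q' := by
      rw [hq', hM, h1, h2]
      simp only [map_add, map_sub, map_mul]
      ring
    refine ⟨hfst, ?_⟩
    simp only [hfst]
    rw [hq', hM, h1, h2]
    simp only [map_add, map_sub, map_mul]
    ring

-- At x = 0 the moments m₀ and m₁ cancel between the two components, so the coefficients up to X³
-- depend only on R and the weight.
open Polynomial in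
lemma exists_transmission_polynomial (R : ℝ) (L : List (ℝ × ℝ × ℝ))
    (hR : (L.map Prod.fst).sum = R) :
    ∃ p q : ℝ[X], X * (transfer (-X ^ 2 : ℝ[X]) L (1, X - X ^ 2 * C R)).1 +
        (transfer (-X ^ 2 : ℝ[X]) L (1, X - X ^ 2 * C R)).2 = C 2 * X * p ∧
      p = 1 - C R * X + C (R ^ 2 / 2) * X ^ 2 + C (weight 0 L / 2 - R ^ 3 / 6) * X ^ 3 + X ^ 4 * q := by
  obtain ⟨m₀, m₁, q, r, h1, h2⟩ := transfer_expansion R L 0 (by simpa using hR)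
  refine ⟨_, C (1 / 2) * (q + r), ?_, rfl⟩
  have e1 : R ^ 2 / 2 = 1 / 2 * R ^ 2 := by ring
  have e2 : weight 0 L / 2 - R ^ 3 / 6 = 1 / 2 * (weight 0 L - R ^ 3 / 3) := by ring
  have e3 : weight 0 L + 2 * (m₁ + 0 * m₀) - (R ^ 3 - 0 ^ 3) / 3 - R * m₀ =
    (weight 0 L - R ^ 3 / 3) + (2 * m₁ - R * m₀) := by ring
  have hC : (C 2 : ℝ[X]) * C (1 / 2) = 1 := by rw [← C_mul]; norm_num
  have hC2 : (C 2 : ℝ[X]) = 2 := rfl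
  rw [h1, h2, e1, e2, e3, sub_zero]
  set W := weight 0 L - R ^ 3 / 3
  simp only [map_add, map_sub, map_mul, map_pow]
  rw [hC2] at hC ⊢
  linear_combination (-(C R ^ 2 * X ^ 3 + C W * X ^ 4 + X ^ 5 * (q + r))) * hC

end IndefString

/-! ### Factorization into 1 - ρX and power sums. -/

open Polynomial in
lemma exists_multiset_inv_roots (P : ℂ[X]) (hP : P.eval 0 = 1) :
    ∃ M : Multiset ℂ, (∀ ρ ∈ M, ρ ≠ 0) ∧ P = (M.map fun ρ => 1 - C ρ * X).prod := by
  have hsplit := (IsAlgClosed.splits P).eq_prod_roots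
  have hr : ∀ r ∈ P.roots, r ≠ 0 := by
    rintro r hr rfl
    have := isRoot_of_mem_roots hr
    rw [IsRoot, hP] at this
    exact one_ne_zero this
  refine ⟨P.roots.map (·⁻¹), ?_, ?_⟩
  · intro ρ hρ
    obtain ⟨r, h, rfl⟩ := Multiset.mem_map.mp hρ
    exact inv_ne_zero (hr r h)
  · have key : ∀ s : Multiset ℂ, (∀ r ∈ s, r ≠ 0) →
        (s.map fun r => X - C r).prod =
          C ((s.map fun r => X - C r).prod.eval 0) * (s.map fun r => 1 - C r⁻¹ * X).prod := by
      intro s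
      induction s using Multiset.induction with
      | empty => simp
      | cons r s ih =>
        intro h
        have hr0 := h r (Multiset.mem_cons_self r s)
        have ih' := ih fun r hr => h r (Multiset.mem_cons_of_mem hr)
        simp only [Multiset.map_cons, Multiset.prod_cons, eval_mul, eval_sub, eval_X, eval_C,
          zero_sub, map_mul, map_neg]
        have hC : (C r : ℂ[X]) * C r⁻¹ = 1 := by rw [← C_mul, mul_inv_cancel₀ hr0, C_1]
        set e := C ((s.map fun r => X - C r).prod.eval 0)
        rw [ih']
        linear_combination (-(e * (s.map fun r => 1 - C r⁻¹ * X).prod * X)) * hC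
    rw [Multiset.map_map]
    have h0 : P.leadingCoeff * (P.roots.map fun r => X - C r).prod.eval 0 = 1 := by
      rw [← hP]
      conv_rhs => rw [hsplit]
      simp
    conv_lhs => rw [hsplit, key _ hr, ← mul_assoc, ← C_mul, h0, C_1, one_mul]
    rfl

-- Newton's identities for the first three elementary symmetric functions, with 6 clearing the
-- denominators.
open Polynomial in
lemma prod_one_sub_expansion (M : Multiset ℂ) : ∃ q : ℂ[X],
    C 6 * (M.map fun ρ => 1 - C ρ * X).prod = C 6 - C (6 * M.sum) * X
      + C (3 * (M.sum ^ 2 - (M.map (· ^ 2)).sum)) * X ^ 2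
      - C (M.sum ^ 3 - 3 * M.sum * (M.map (· ^ 2)).sum + 2 * (M.map (· ^ 3)).sum) * X ^ 3
      + X ^ 4 * q := by
  induction M using Multiset.induction with
  | empty => exact ⟨0, by simp⟩
  | cons ρ M ih =>
    obtain ⟨q, hq⟩ := ih
    refine ⟨q - C ρ * (-C (M.sum ^ 3 - 3 * M.sum * (M.map (· ^ 2)).sum + 2 * (M.map (· ^ 3)).sum) +
      X * q), ?_⟩
    simp only [Multiset.map_cons, Multiset.prod_cons, Multiset.sum_cons]
    rw [mul_left_comm, hq]
    have h2 : (C 2 : ℂ[X]) = 2 := rfl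
    have h3 : (C 3 : ℂ[X]) = 3 := rfl
    have h6 : (C 6 : ℂ[X]) = 6 := rfl
    simp only [map_add, map_sub, map_mul, map_pow, h2, h3, h6]
    ring

/-! ### Absolutely continuous complex functions and the space H¹_loc. -/

lemma AbsolutelyContinuousOnInterval.lipschitz_comp {X Y : Type*} [PseudoMetricSpace X]
    [PseudoMetricSpace Y] {f : ℝ → X} {g : X → Y} {a b : ℝ}
    (hf : AbsolutelyContinuousOnInterval f a b) (hg : LipschitzWith 1 g) :
    AbsolutelyContinuousOnInterval (fun x => g (f x)) a b := by
  rw [absolutelyContinuousOnInterval_iff] at hf ⊢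
  intro ε hε
  obtain ⟨δ, hδ, h⟩ := hf ε hε
  refine ⟨δ, hδ, fun E hE hs => (Finset.sum_le_sum fun i _ => ?_).trans_lt (h E hE hs)⟩
  simpa using hg.dist_le_mul (f (E.2 i).1) (f (E.2 i).2)

lemma Complex.lipschitzWith_re : LipschitzWith 1 Complex.re :=
  LipschitzWith.of_dist_le_mul fun x y => by
    simpa [Complex.dist_eq, Real.dist_eq] using Complex.abs_re_le_norm (x - y)

lemma Complex.lipschitzWith_im : LipschitzWith 1 Complex.im :=
  LipschitzWith.of_dist_le_mul fun x y => by
    simpa [Complex.dist_eq, Real.dist_eq] using Complex.abs_im_le_norm (x - y)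

lemma AbsolutelyContinuousOnInterval.ae_hasDerivAt_complex {f : ℝ → ℂ} {a b : ℝ}
    (hf : AbsolutelyContinuousOnInterval f a b) : ∀ᵐ x : ℝ, x ∈ uIcc a b →
      HasDerivAt f (((deriv (fun t => (f t).re) x : ℝ) : ℂ)
        + ((deriv (fun t => (f t).im) x : ℝ) : ℂ) * Complex.I) x := by
  filter_upwards [(hf.lipschitz_comp Complex.lipschitzWith_re).ae_differentiableAt,
    (hf.lipschitz_comp Complex.lipschitzWith_im).ae_differentiableAt] with x h1 h2 hx
  have := (h1 hx).hasDerivAt.ofReal_comp.add ((h2 hx).hasDerivAt.ofReal_comp.mul_const Complex.I)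
  refine this.congr_of_eventuallyEq (Filter.Eventually.of_forall fun t => ?_)
  simp [Complex.re_add_im]

lemma AbsolutelyContinuousOnInterval.setIntegral_deriv_complex {f : ℝ → ℂ} {a b : ℝ} (hab : a ≤ b)
    (hf : AbsolutelyContinuousOnInterval f a b) :
    ∫ x in Ioo a b, deriv f x = f b - f a := by
  have hre := hf.lipschitz_comp Complex.lipschitzWith_re
  have him := hf.lipschitz_comp Complex.lipschitzWith_im
  rw [← integral_Ioc_eq_integral_Ioo, ← intervalIntegral.integral_of_le hab]
  have h1 : ∫ x in a..b, deriv f x = ∫ x in a..b, (((deriv (fun t => (f t).re) x : ℝ) : ℂ)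
        + ((deriv (fun t => (f t).im) x : ℝ) : ℂ) * Complex.I) := by
    refine intervalIntegral.integral_congr_ae ?_
    filter_upwards [hf.ae_hasDerivAt_complex] with x hx hx'
    exact (hx (uIoc_subset_uIcc hx')).deriv
  have ire : IntervalIntegrable (fun x => ((deriv (fun t => (f t).re) x : ℝ) : ℂ)) volume a b :=
    ⟨hre.intervalIntegrable_deriv.1.ofReal, hre.intervalIntegrable_deriv.2.ofReal⟩
  have iim : IntervalIntegrable (fun x => ((deriv (fun t => (f t).im) x : ℝ) : ℂ)) volume a b :=
    ⟨him.intervalIntegrable_deriv.1.ofReal, him.intervalIntegrable_deriv.2.ofReal⟩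
  rw [h1, intervalIntegral.integral_add ire (iim.mul_const _), intervalIntegral.integral_mul_const,
    intervalIntegral.integral_ofReal, intervalIntegral.integral_ofReal, hre.integral_deriv_eq_sub,
    him.integral_deriv_eq_sub]
  apply Complex.ext <;> simp

namespace IndefString

lemma MemH1loc.absolutelyContinuous {f : ℝ → ℂ} (hf : MemH1loc f) {a b : ℝ} (ha : 0 ≤ a)
    (hab : a ≤ b) : AbsolutelyContinuousOnInterval f a b := by
  refine (hf.1 (b + 1) (by linarith)).mono ?_
  rw [uIcc_of_le hab, uIcc_of_le (by linarith)]
  exact Icc_subset_Icc ha (by linarith)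

lemma MemH1loc.continuousOn {f : ℝ → ℂ} (hf : MemH1loc f) {b : ℝ} (hb : 0 ≤ b) :
    ContinuousOn f (Icc 0 b) := by
  have := (hf.absolutelyContinuous le_rfl hb).continuousOn
  rwa [uIcc_of_le hb] at this

lemma MemH1loc.setIntegral_deriv {f : ℝ → ℂ} (hf : MemH1loc f) {a b : ℝ} (ha : 0 ≤ a)
    (hab : a ≤ b) : ∫ x in Ioo a b, deriv f x = f b - f a :=
  (hf.absolutelyContinuous ha hab).setIntegral_deriv_complex hab

lemma MemH1loc.ae_differentiableAt {f : ℝ → ℂ} (hf : MemH1loc f) (b : ℝ) :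
    ∀ᵐ x ∂volume.restrict (Ioo 0 b), DifferentiableAt ℝ f x := by
  rw [ae_restrict_iff' measurableSet_Ioo]
  rcases le_or_gt b 0 with hb | hb
  · refine Filter.Eventually.of_forall fun x hx => ?_
    linarith [hx.1, hx.2]
  filter_upwards [(hf.1 b hb).ae_hasDerivAt_complex] with x hx hx'
  refine (hx ?_).differentiableAt
  rw [uIcc_of_le hb.le]
  exact Ioo_subset_Icc_self hx'

lemma MemH1loc.ae_deriv_mul {f h : ℝ → ℂ} (hf : MemH1loc f) (hh : MemH1loc h) (b : ℝ) :
    ∀ᵐ x ∂volume.restrict (Ioo 0 b),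
      deriv (fun x => f x * h x) x = deriv f x * h x + f x * deriv h x := by
  filter_upwards [hf.ae_differentiableAt b, hh.ae_differentiableAt b] with x h1 h2
  exact deriv_fun_mul h1 h2

lemma MemH1loc.memLp_top {f : ℝ → ℂ} (hf : MemH1loc f) {b : ℝ} (hb : 0 < b) :
    MemLp f ⊤ (volume.restrict (Ioo 0 b)) := by
  obtain ⟨C, hC⟩ := (hf.1 b hb).exists_bound
  refine memLp_top_of_bound
    (((hf.continuousOn hb.le).mono Ioo_subset_Icc_self).aestronglyMeasurable measurableSet_Ioo) C ?_
  refine (ae_restrict_iff' measurableSet_Ioo).mpr (Filter.Eventually.of_forall fun x hx => hC x ?_)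
  rw [uIcc_of_le hb.le]
  exact Ioo_subset_Icc_self hx

lemma MemH1loc.mul {f h : ℝ → ℂ} (hf : MemH1loc f) (hh : MemH1loc h) :
    MemH1loc (fun x => f x * h x) := by
  refine ⟨fun b hb => (hf.1 b hb).smul (hh.1 b hb), fun b hb => ?_⟩
  have h1 : MemLp (fun x => deriv f x * h x) 2 (volume.restrict (Ioo 0 b)) :=
    (hh.memLp_top hb).mul (hf.2 b hb)
  have h2 : MemLp (fun x => f x * deriv h x) 2 (volume.restrict (Ioo 0 b)) :=
    (hh.2 b hb).mul (hf.memLp_top hb)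
  exact (memLp_congr_ae (hf.ae_deriv_mul hh b)).mpr (h1.add h2)

/-- Every solution and test function constructed below is locally Lipschitz, so this settles their
membership. -/
lemma memH1loc_of_locallyLipschitz {f : ℝ → ℂ} (hf : LocallyLipschitz f) : MemH1loc f := by
  have key : ∀ b : ℝ, ∃ K, LipschitzOnWith K f (Icc 0 b) := fun b =>
    (hf.locallyLipschitzOn).exists_lipschitzOnWith_of_compact isCompact_Icc
  refine ⟨fun b hb => ?_, fun b hb => ?_⟩
  · obtain ⟨K, hK⟩ := key b
    rw [← uIcc_of_le hb.le] at hK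
    exact hK.absolutelyContinuousOnInterval
  · obtain ⟨K, hK⟩ := key b
    have : MemLp (deriv f) ⊤ (volume.restrict (Ioo 0 b)) := by
      refine memLp_top_of_bound (measurable_deriv f).aestronglyMeasurable K ?_
      refine (ae_restrict_iff' measurableSet_Ioo).mpr (Filter.Eventually.of_forall fun x hx => ?_)
      exact norm_deriv_le_of_lipschitzOn (Icc_mem_nhds hx.1 hx.2) hK
    exact this.mono_exponent le_top

lemma memH1c_of_locallyLipschitz {f : ℝ → ℂ} (hf : LocallyLipschitz f) {b : ℝ}
    (hb : ∀ x, b ≤ x → f x = 0) : MemH1c f := by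
  have hf' := memH1loc_of_locallyLipschitz hf
  set B := max b 1 with hB
  have hB0 : 0 < B := lt_of_lt_of_le one_pos (le_max_right _ _)
  have hz : ∀ x, B < x → f x = 0 ∧ deriv f x = 0 := by
    intro x hx
    refine ⟨hb x ((le_max_left _ _).trans hx.le), ?_⟩
    have : f =ᶠ[nhds x] fun _ => 0 := by
      filter_upwards [Ioi_mem_nhds hx] with y hy
      exact hb y ((le_max_left _ _).trans (le_of_lt hy))
    rw [this.deriv_eq, deriv_const]
  have ext : ∀ g : ℝ → ℂ, MemLp g 2 (volume.restrict (Ioo 0 (B + 1))) → (∀ x, B < x → g x = 0) →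
      MemLp g 2 (volume.restrict (Ioi 0)) := by
    intro g hg hgz
    have h1 : MemLp ((Ioo 0 (B + 1)).indicator g) 2 volume :=
      (memLp_indicator_iff_restrict measurableSet_Ioo).mpr hg
    have h2 : (Ioo 0 (B + 1)).indicator g = (Ioi 0).indicator g := by
      ext x
      by_cases hx : 0 < x
      · by_cases hx' : x < B + 1
        · rw [indicator_of_mem (show x ∈ Ioo 0 (B + 1) from ⟨hx, hx'⟩),
            indicator_of_mem (show x ∈ Ioi (0 : ℝ) from hx)]
        · rw [indicator_of_notMem (fun h => hx' h.2), indicator_of_mem (show x ∈ Ioi (0 : ℝ) from hx),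
            hgz x (by linarith)]
      · rw [indicator_of_notMem (fun h => hx h.1), indicator_of_notMem (show x ∉ Ioi (0 : ℝ) from hx)]
    rw [h2] at h1
    exact (memLp_indicator_iff_restrict measurableSet_Ioi).mp h1
  refine ⟨⟨hf', ?_, ?_⟩, b, hb⟩
  · exact ext f ((hf'.memLp_top (by linarith)).mono_exponent le_top) fun x hx => (hz x hx).1
  · exact ext _ (hf'.2 _ (by linarith)) fun x hx => (hz x hx).2

end IndefString

/-! ### The weak equation in integrated form, and the Jost solutions. -/

namespace IndefString

instance (S : GenString) : IsLocallyFiniteMeasure S.υ := S.υ_locallyFinite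

/-- The density with respect to Lebesgue measure of the bilinear form of `-f'' = z ω f + z² υ f`. -/
noncomputable def GenString.form (S : GenString) (z : ℂ) (f h : ℝ → ℂ) (x : ℝ) : ℂ :=
  deriv f x * deriv h x + z * ((S.w x : ℂ) * deriv (fun y => f y * h y) x)

/-- The bilinear form of the differential equation on the interval `[x, y)`. -/
noncomputable def GenString.flux (S : GenString) (z : ℂ) (f h : ℝ → ℂ) (x y : ℝ) : ℂ :=
  (∫ t in Ioo x y, S.form z f h t) - z ^ 2 * ∫ t in Ico x y, f t * h t ∂S.υ

variable {S : GenString} {z : ℂ} {f h : ℝ → ℂ}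

/-- This symmetry lets a Jost solution serve as the test function for a constructed local solution.
-/
lemma GenString.flux_comm (x y : ℝ) : S.flux z f h x y = S.flux z h f x y := by
  simp only [flux, form, mul_comm (f _) (h _), mul_comm (deriv f _)]

lemma MemH1loc.integrableOn_deriv_mul_deriv (hf : MemH1loc f) (hh : MemH1loc h) {b : ℝ}
    (hb : 0 < b) : IntegrableOn (fun x => deriv f x * deriv h x) (Ioo 0 b) :=
  (hf.2 b hb).integrable_mul (hh.2 b hb)

lemma MemH1loc.integrableOn_w_mul (hf : MemH1loc f) {b : ℝ}
    (hb : 0 < b) : IntegrableOn (fun x => (S.w x : ℂ) * deriv f x) (Ioo 0 b) :=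
  (S.w_memLp b hb).ofReal.integrable_mul (hf.2 b hb)

lemma GenString.integrableOn_form (hf : MemH1loc f) (hh : MemH1loc h) {b : ℝ} (hb : 0 < b) :
    IntegrableOn (S.form z f h) (Ioo 0 b) :=
  (hf.integrableOn_deriv_mul_deriv hh hb).add (((hf.mul hh).integrableOn_w_mul hb).const_mul z)

lemma GenString.flux_add (hf : MemH1loc f) (hh : MemH1loc h) {x y r : ℝ} (hx : 0 ≤ x) (hxy : x < y)
    (hyr : y ≤ r) : S.flux z f h x r = S.flux z f h x y + S.flux z f h y r := by
  have hform := S.integrableOn_form (z := z) hf hh (show 0 < r by linarith)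
  have hmass : IntegrableOn (fun t => f t * h t) (Icc 0 r) S.υ :=
    ((hf.mul hh).continuousOn (by linarith)).integrableOn_compact isCompact_Icc
  have e1 : ∫ t in Ioo x r, S.form z f h t =
      (∫ t in Ioo x y, S.form z f h t) + ∫ t in Ioo y r, S.form z f h t := by
    rw [← integral_Ico_eq_integral_Ioo (x := y), ← setIntegral_union _ measurableSet_Ico,
      Ioo_union_Ico_eq_Ioo hxy hyr]
    · exact hform.mono_set (Ioo_subset_Ioo hx hyr)
    · rw [integrableOn_Ico_iff_integrableOn_Ioo]
      exact hform.mono_set (Ioo_subset_Ioo (by linarith) le_rfl)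
    · exact disjoint_left.mpr fun t ht ht' => absurd ht.2 (not_lt.mpr ht'.1)
  have e2 : ∫ t in Ico x r, f t * h t ∂S.υ =
      (∫ t in Ico x y, f t * h t ∂S.υ) + ∫ t in Ico y r, f t * h t ∂S.υ := by
    rw [← setIntegral_union _ measurableSet_Ico, Ico_union_Ico_eq_Ico hxy.le hyr]
    · exact hmass.mono_set (Ico_subset_Icc_self.trans (Icc_subset_Icc hx hyr))
    · exact hmass.mono_set (Ico_subset_Icc_self.trans (Icc_subset_Icc (by linarith) le_rfl))
    · exact disjoint_left.mpr fun t ht ht' => absurd ht.2 (not_lt.mpr ht'.1)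
  rw [flux, flux, flux, e1, e2]
  ring

lemma GenString.flux_congr {g : ℝ → ℂ} {x y : ℝ} (hfg : EqOn f g (Icc x y)) :
    S.flux z f h x y = S.flux z g h x y := by
  have e1 : ∫ t in Ioo x y, S.form z f h t = ∫ t in Ioo x y, S.form z g h t := by
    refine setIntegral_congr_fun measurableSet_Ioo fun t ht => ?_
    have : f =ᶠ[nhds t] g := hfg.eventuallyEq_of_mem (Icc_mem_nhds ht.1 ht.2)
    simp only [form]
    have hmul : (fun y => f y * h y) =ᶠ[nhds t] fun y => g y * h y :=
      this.mul (Filter.EventuallyEq.refl _ h)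
    rw [this.deriv_eq, hmul.deriv_eq]
  have e2 : ∫ t in Ico x y, f t * h t ∂S.υ = ∫ t in Ico x y, g t * h t ∂S.υ :=
    setIntegral_congr_fun measurableSet_Ico fun t ht => by
      simp only [hfg (Ico_subset_Icc_self ht)]
  rw [flux, flux, e1, e2]

/-- The integrand is an exact derivative, so only boundary values of (f' + z w f)h remain. The
half-open interval charges the mass at x to its left end, in accordance with f'(0-) when x = 0. -/
lemma GenString.flux_linear (hf : MemH1loc f) (hh : MemH1loc h) {x y c : ℝ} {m : ℂ} (hx : 0 ≤ x)
    (hxy : x < y) (hlin : ∀ t ∈ Icc x y, f t = f y + m * (t - y))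
    (hw : ∀ᵐ t ∂volume.restrict (Ioo x y), S.w t = c) (hυ : S.υ (Ioo x y) = 0) :
    S.flux z f h x y = (m + z * c * f y) * h y
      - (m + z * c * f x + z ^ 2 * S.υ.real {x} * f x) * h x := by
  have hy : 0 < y := by linarith
  have hsub : Ioo x y ⊆ Ioo 0 y := Ioo_subset_Ioo hx le_rfl
  have hint1 : IntegrableOn (deriv h) (Ioo x y) :=
    ((hh.2 y hy).integrable (by norm_num)).mono_measure (Measure.restrict_mono hsub le_rfl)
  have hint2 : IntegrableOn (deriv fun t => f t * h t) (Ioo x y) :=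
    (((hf.mul hh).2 y hy).integrable (by norm_num)).mono_measure (Measure.restrict_mono hsub le_rfl)
  have e1 : ∫ t in Ioo x y, S.form z f h t =
      ∫ t in Ioo x y, (m * deriv h t + z * c * deriv (fun t => f t * h t) t) := by
    refine setIntegral_congr_ae measurableSet_Ioo ?_
    rw [ae_restrict_iff' measurableSet_Ioo] at hw
    filter_upwards [hw] with t ht ht'
    have : f =ᶠ[nhds t] fun t => f y + m * (t - y) :=
      (show EqOn f _ (Icc x y) from hlin).eventuallyEq_of_mem (Icc_mem_nhds ht'.1 ht'.2)
    have hd : HasDerivAt (fun t : ℝ => f y + m * ((t : ℂ) - y)) m t := by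
      have h1 : HasDerivAt (fun t : ℝ => (t : ℂ)) 1 t := Complex.ofRealCLM.hasDerivAt
      simpa using ((h1.sub_const (y : ℂ)).const_mul m).const_add (f y)
    rw [form, ht ht', this.deriv_eq, hd.deriv]
    ring
  have e2 : ∫ t in Ico x y, f t * h t ∂S.υ = S.υ.real {x} * (f x * h x) := by
    have : S.υ.restrict (Ico x y) = S.υ.restrict {x} := by
      refine Measure.restrict_congr_set ?_
      rw [← Ioo_union_left hxy]
      have := (ae_eq_empty.mpr hυ).union (Filter.EventuallyEq.refl (ae S.υ) ({x} : Set ℝ))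
      simpa using this
    rw [this, integral_singleton, Complex.real_smul]
  rw [flux, e1, e2, integral_add (hint1.const_mul m) (hint2.const_mul _), integral_const_mul,
    integral_const_mul, hh.setIntegral_deriv hx hxy.le, (hf.mul hh).setIntegral_deriv hx hxy.le]
  have hfx := hlin x ⟨le_rfl, hxy.le⟩
  ring

/-- With w(x) = x the form density equals (Eh)', where E = f' + z w f = (s - s²x)e^{sx}. -/
lemma GenString.flux_exp {s : ℂ} {R b : ℝ} (hh : MemH1loc h) (hR : 0 ≤ R)
    (hRb : R < b) (hexp : ∀ t, R ≤ t → f t = Complex.exp (s * t))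
    (hw : ∀ᵐ x ∂(volume.restrict (Ici R)), S.w x = x) (hυ : S.υ (Ici R) = 0) :
    S.flux (-s ^ 2) f h R b = (s - s ^ 2 * b) * Complex.exp (s * b) * h b
      - (s - s ^ 2 * R) * Complex.exp (s * R) * h R := by
  set E : ℝ → ℂ := fun t => (s - s ^ 2 * t) * Complex.exp (s * t) with hE
  have hof : ∀ t : ℝ, HasDerivAt (fun t : ℝ => (t : ℂ)) 1 t := fun t => Complex.ofRealCLM.hasDerivAt
  have hdexp : ∀ t : ℝ, HasDerivAt (fun t : ℝ => Complex.exp (s * t)) (Complex.exp (s * t) * s) t := by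
    intro t
    simpa using ((hof t).const_mul s).cexp
  have hdE : ∀ t : ℝ, HasDerivAt E (-s ^ 3 * t * Complex.exp (s * t)) t := by
    intro t
    have h1 := (((hof t).const_mul (s ^ 2)).const_sub s).mul (hdexp t)
    refine h1.congr_deriv ?_
    ring
  have hEl : MemH1loc E := by
    refine memH1loc_of_locallyLipschitz (ContDiff.locallyLipschitz (𝕂 := ℝ) ?_)
    have : ContDiff ℝ 1 (fun t : ℝ => (t : ℂ)) := Complex.ofRealCLM.contDiff
    exact (contDiff_const.sub (contDiff_const.mul this)).mul
      (contDiff_const.mul this).cexp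
  have e2 : ∫ t in Ico R b, f t * h t ∂S.υ = 0 := by
    rw [setIntegral_measure_zero]
    exact measure_mono_null (fun t ht => ht.1) hυ
  have e1 : ∫ t in Ioo R b, S.form (-s ^ 2) f h t = ∫ t in Ioo R b, deriv (fun t => E t * h t) t := by
    refine setIntegral_congr_ae measurableSet_Ioo ?_
    rw [ae_restrict_iff' measurableSet_Ici] at hw
    have hd := hh.ae_differentiableAt b
    rw [ae_restrict_iff' measurableSet_Ioo] at hd
    filter_upwards [hw, hd] with t ht htd ht'
    have hdh := (htd ⟨lt_of_le_of_lt hR ht'.1, ht'.2⟩).hasDerivAt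
    have hfe : f =ᶠ[nhds t] fun t : ℝ => Complex.exp (s * t) := by
      filter_upwards [Ioi_mem_nhds ht'.1] with u hu
      exact hexp u (le_of_lt hu)
    have hdf := (hdexp t).congr_of_eventuallyEq hfe
    rw [form, ht ht'.1.le, ((hdE t).fun_mul hdh).deriv, (hdf.fun_mul hdh).deriv, hdf.deriv,
      hexp t ht'.1.le]
    ring
  rw [flux, e1, e2, (hEl.mul hh).setIntegral_deriv hR hRb.le]
  ring

/-- The strict inequality b₀ < b makes h vanish near every point from b on, so its derivative
vanishes there too. -/
lemma GenString.weak_form_eq_flux (hf : MemH1loc f) (hh : MemH1loc h) {b₀ b : ℝ} (hb : 0 < b)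
    (hb₀ : b₀ < b) (hz : ∀ x, b₀ ≤ x → h x = 0) :
    (∫ x in Ioi (0 : ℝ), deriv f x * deriv h x) - z * S.omega (fun x => f x * h x)
      - z ^ 2 * ∫ x in Ici (0 : ℝ), f x * h x ∂S.υ = S.flux z f h 0 b := by
  have hev : ∀ t, b ≤ t → h =ᶠ[nhds t] fun _ => 0 := by
    intro t ht
    filter_upwards [Ioi_mem_nhds (hb₀.trans_le ht)] with u hu
    exact hz u (le_of_lt hu)
  have e1 : ∫ x in Ioi (0 : ℝ), deriv f x * deriv h x = ∫ x in Ioo 0 b, deriv f x * deriv h x := by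
    refine setIntegral_eq_of_subset_of_forall_sdiff_eq_zero measurableSet_Ioi Ioo_subset_Ioi_self ?_
    rintro t ⟨ht0, ht⟩
    have : b ≤ t := not_lt.mp fun h' => ht ⟨ht0, h'⟩
    rw [(hev t this).deriv_eq, deriv_const, mul_zero]
  have e2 : S.omega (fun x => f x * h x) =
      -∫ x in Ioo 0 b, (S.w x : ℂ) * deriv (fun x => f x * h x) x := by
    rw [omega]
    congr 1
    refine setIntegral_eq_of_subset_of_forall_sdiff_eq_zero measurableSet_Ioi Ioo_subset_Ioi_self ?_
    rintro t ⟨ht0, ht⟩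
    have : b ≤ t := not_lt.mp fun h' => ht ⟨ht0, h'⟩
    have h0 : (fun x => f x * h x) =ᶠ[nhds t] fun _ => 0 := by
      filter_upwards [hev t this] with u hu
      rw [hu, mul_zero]
    rw [h0.deriv_eq, deriv_const, mul_zero]
  have e3 : ∫ x in Ici (0 : ℝ), f x * h x ∂S.υ = ∫ x in Ico 0 b, f x * h x ∂S.υ := by
    refine setIntegral_eq_of_subset_of_forall_sdiff_eq_zero measurableSet_Ici Ico_subset_Ici_self ?_
    rintro t ⟨ht0, ht⟩
    have : b ≤ t := not_lt.mp fun h' => ht ⟨ht0, h'⟩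
    rw [hz t (by linarith), mul_zero]
  rw [e1, e2, e3, flux]
  simp only [form]
  rw [integral_add (hf.integrableOn_deriv_mul_deriv hh hb)
    (((hf.mul hh).integrableOn_w_mul hb).const_mul z), integral_const_mul]
  ring

/-- The interval `[x, R)` is partitioned into intervals in whose interior `w` is constant and `υ`
vanishes; the list has the lengths, the values of `w` and the point masses at the left ends. -/
inductive GenString.IsPartition (S : GenString) (R : ℝ) : ℝ → List (ℝ × ℝ × ℝ) → Prop
  | nil : IsPartition S R R []
  | cons {x l c : ℝ} {L : List (ℝ × ℝ × ℝ)} (hl : 0 < l)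
      (hw : ∀ᵐ t ∂volume.restrict (Ioo x (x + l)), S.w t = c) (hυ : S.υ (Ioo x (x + l)) = 0)
      (hL : IsPartition S R (x + l) L) : IsPartition S R x ((l, c, S.υ.real {x}) :: L)

lemma GenString.IsPartition.add_sum {R x : ℝ} {L : List (ℝ × ℝ × ℝ)} (hL : S.IsPartition R x L) :
    x + (L.map Prod.fst).sum = R := by
  induction hL with
  | nil => simp
  | cons hl hw hυ hL ih => simpa [add_assoc] using ih

lemma GenString.IsPartition.pos {R x : ℝ} {L : List (ℝ × ℝ × ℝ)} (hL : S.IsPartition R x L) :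
    ∀ t ∈ L, 0 < t.1 ∧ 0 ≤ t.2.2 := by
  induction hL with
  | nil => simp
  | cons hl hw hυ hL ih => simpa [hl] using ih

lemma GenString.IsPartition.le {R x : ℝ} {L : List (ℝ × ℝ × ℝ)} (hL : S.IsPartition R x L) :
    x ≤ R := by
  induction hL with
  | nil => exact le_rfl
  | cons hl hw hυ hL ih => linarith

/-- Solves leftwards from R with prescribed data (u(R), g) and keeps u to the right of R. A smooth u
= e^{sx} gives the Jost solution; a compactly supported u gives a test function. -/
lemma GenString.IsPartition.exists_solution {R x : ℝ} {L : List (ℝ × ℝ × ℝ)}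
    (hL : S.IsPartition R x L) (hx : 0 ≤ x) {u : ℝ → ℂ} (hu : LocallyLipschitz u) (z g : ℂ) :
    ∃ φ : ℝ → ℂ, LocallyLipschitz φ ∧ EqOn φ u (Ici R) ∧ φ x = (transfer z L (u R, g)).1 ∧
      ∀ h, MemH1loc h →
        S.flux z φ h x R = g * h R - (transfer z L (u R, g)).2 * h x := by
  induction hL with
  | nil => exact ⟨u, hu, fun _ _ => rfl, rfl, fun h _ => by simp [flux, transfer]⟩
  | @cons x l c L hl hw hυ hL ih =>
    obtain ⟨φ, hφ, hφu, hφx, hflux⟩ := ih (by linarith)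
    set q := transfer z L (u R, g) with hq
    set y := x + l with hy
    have hyR : y ≤ R := hL.le
    set m := q.2 - z * c * q.1 with hm
    have hstep : transfer z ((l, c, S.υ.real {x}) :: L) (u R, g) = (q.1 - l * m,
      m + z * c * (q.1 - l * m) + z ^ 2 * S.υ.real {x} * (q.1 - l * m)) := rfl
    -- The function φ to the right of y, glued to the line of slope m through (y, φ(y)) to the left.
    set ψ : ℝ → ℂ := fun t => φ (max t y) + m * ((min t y : ℝ) - y) with hψ
    have hψy : ∀ t, y ≤ t → ψ t = φ t := by
      intro t ht
      simp [hψ, max_eq_left ht, min_eq_right ht]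
    have hψx : ∀ t, t ≤ y → ψ t = q.1 + m * (t - y) := by
      intro t ht
      simp [hψ, max_eq_right ht, min_eq_left ht, hφx]
    have hψl : LocallyLipschitz ψ := by
      have h1 : LocallyLipschitz fun t => φ (max t y) :=
        hφ.comp (LocallyLipschitz.id.max_const y)
      have h2 : LocallyLipschitz fun t : ℝ => m * (((t : ℝ) : ℂ) - y) := by
        refine ContDiff.locallyLipschitz (𝕂 := ℝ) ?_
        have : ContDiff ℝ 1 (fun t : ℝ => (t : ℂ)) := Complex.ofRealCLM.contDiff
        exact contDiff_const.mul (this.sub contDiff_const)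
      exact h1.add (h2.comp (LocallyLipschitz.id.min_const y))
    have hxy : x < y := by linarith
    refine ⟨ψ, hψl, fun t ht => (hψy t (hyR.trans ht)).trans (hφu ht), ?_, fun h hh => ?_⟩
    · rw [hstep, hψx x hxy.le, hy]
      push_cast; ring
    · rw [flux_add (memH1loc_of_locallyLipschitz hψl) hh hx hxy hyR,
        flux_congr (f := ψ) (g := φ) (x := y) (fun t ht => hψy t ht.1), hflux h hh,
        flux_linear (memH1loc_of_locallyLipschitz hψl) hh hx hxy (m := m) (c := c) ?_ hw hυ,
        hstep, hψx y le_rfl, hψx x hxy.le, hy]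
      · rw [hm]; push_cast; ring
      · intro t ht
        rw [hψx t ht.2, hψx y le_rfl]; ring

lemma GenString.exists_isJost {R : ℝ} (hS : S.MemF0 R) {L : List (ℝ × ℝ × ℝ)}
    (hL : S.IsPartition R 0 L) (k : ℂ) : ∃ f d, S.IsJost R k f d := by
  set s := Complex.I * k with hs
  have hsk : k ^ 2 = -s ^ 2 := by rw [hs, mul_pow, Complex.I_sq]; ring
  have hu : LocallyLipschitz fun t : ℝ => Complex.exp (s * t) := by
    refine ContDiff.locallyLipschitz (𝕂 := ℝ) ?_
    have : ContDiff ℝ 1 (fun t : ℝ => (t : ℂ)) := Complex.ofRealCLM.contDiff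
    exact (contDiff_const.mul this).cexp
  obtain ⟨f, hf, hfu, hf0, hflux⟩ := hL.exists_solution le_rfl hu (k ^ 2)
    ((s - s ^ 2 * R) * Complex.exp (s * R))
  have hf' := memH1loc_of_locallyLipschitz hf
  refine ⟨f, (transfer (k ^ 2) L (Complex.exp (s * R), (s - s ^ 2 * R) * Complex.exp (s * R))).2,
    ⟨hf', fun h hh => ?_⟩, fun x hx => hfu hx⟩
  · obtain ⟨⟨hh', -⟩, b₀, hb₀⟩ := hh
    set b := max b₀ R + 1 with hb
    have hb1 : b₀ < b := by linarith [le_max_left b₀ R]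
    have hb2 : R < b := by linarith [le_max_right b₀ R]
    have h1 := weak_form_eq_flux (S := S) (z := k ^ 2) hf' hh' (hS.R_pos.trans hb2) hb1 hb₀
    have h2 := flux_exp hh' hS.R_pos.le hb2 (fun t ht => hfu ht) hS.w_eq hS.υ_eq
    rw [flux_add hf' hh' le_rfl hS.R_pos hb2.le, hflux h hh', hsk, h2, hb₀ b hb1.le] at h1
    rw [hsk]
    linear_combination h1

/-- Constancy of the Wronskian: an arbitrary Jost solution is tested against a local solution with
data (α, g) at R, and comparing both ends of [0, R] relates f(0) and d. -/
lemma GenString.IsJost.pairing {R : ℝ} (hS : S.MemF0 R) {L : List (ℝ × ℝ × ℝ)}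
    (hL : S.IsPartition R 0 L) {k d s : ℂ} (hs : s = Complex.I * k) (hf : S.IsJost R k f d)
    (α g : ℂ) :
    d * (transfer (-s ^ 2) L (α, g)).1 - (transfer (-s ^ 2) L (α, g)).2 * f 0 =
      ((s - s ^ 2 * R) * α - g) * Complex.exp (s * R) := by
  have hsk : k ^ 2 = -s ^ 2 := by rw [hs, mul_pow, Complex.I_sq]; ring
  -- A tent with value α at R that vanishes from R + 1 on; only its value at R matters.
  set u : ℝ → ℂ := fun t => α * ((max (1 - |t - R|) 0 : ℝ) : ℂ) with hu
  have hul : LocallyLipschitz u := by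
    have h1 : LocallyLipschitz fun t : ℝ => max (1 - |t - R|) 0 := by
      refine LocallyLipschitz.max_const ?_ 0
      have : LipschitzWith 1 fun t : ℝ => 1 - |t - R| := LipschitzWith.of_dist_le_mul fun a b => by
        simp only [Real.dist_eq, NNReal.coe_one, one_mul]
        have := abs_abs_sub_abs_le_abs_sub (a - R) (b - R)
        rw [show 1 - |a - R| - (1 - |b - R|) = -(|a - R| - |b - R|) by ring, abs_neg]
        simpa using this
      exact this.locallyLipschitz
    have h2 : LocallyLipschitz fun t : ℝ => α * (t : ℂ) := by
      refine ContDiff.locallyLipschitz (𝕂 := ℝ) ?_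
      exact contDiff_const.mul Complex.ofRealCLM.contDiff
    exact h2.comp h1
  have huR : u R = α := by simp [hu]
  obtain ⟨φ, hφ, hφu, hφ0, hflux⟩ := hL.exists_solution le_rfl hul (k ^ 2) g
  rw [huR] at hφ0 hflux
  have hφz : ∀ x, R + 1 ≤ x → φ x = 0 := by
    intro x hx
    rw [hφu (show R ≤ x by linarith)]
    have : 1 - |x - R| ≤ 0 := by
      have := le_abs_self (x - R); linarith
    simp [hu, max_eq_right this]
  have hφ' := memH1loc_of_locallyLipschitz hφ
  have hweak := hf.1.2 φ (memH1c_of_locallyLipschitz hφ hφz)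
  have hexp : ∀ t, R ≤ t → f t = Complex.exp (s * t) := fun t ht => by rw [hf.2 t ht, hs]
  have hR2 : R < R + 2 := by linarith
  have h1 := weak_form_eq_flux (S := S) (z := k ^ 2) hf.1.1 hφ' (hS.R_pos.trans hR2)
    (show R + 1 < R + 2 by linarith) hφz
  have h2 := flux_exp hφ' hS.R_pos.le hR2 hexp hS.w_eq hS.υ_eq
  rw [flux_add hf.1.1 hφ' le_rfl hS.R_pos hR2.le, flux_comm 0 R, hflux f hf.1.1, hsk, h2,
    hφz _ (by linarith), hφu (show R ≤ R from le_rfl), huR, hexp R le_rfl] at h1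
  rw [hφ0, hsk] at hweak
  linear_combination hweak - h1

/-- Pairing with two independent local solutions gives a linear system for f(0) and d with
determinant one, so every Jost solution has the data obtained by transfer. -/
lemma GenString.IsJost.eq {R : ℝ} (hS : S.MemF0 R) {L : List (ℝ × ℝ × ℝ)}
    (hL : S.IsPartition R 0 L) {k d s : ℂ} (hs : s = Complex.I * k) (hf : S.IsJost R k f d) :
    s * f 0 + d = Complex.exp (s * R) * (s * (transfer (-s ^ 2) L (1, s - s ^ 2 * R)).1 +
      (transfer (-s ^ 2) L (1, s - s ^ 2 * R)).2) := by
  have h1 := hf.pairing hS hL hs 1 (s - s ^ 2 * R)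
  have h2 := hf.pairing hS hL hs 0 1
  have h3 := transfer_wronskian (-s ^ 2) L (1, s - s ^ 2 * R) (0, 1)
  set F := (transfer (-s ^ 2) L (1, s - s ^ 2 * R)).1
  set G := (transfer (-s ^ 2) L (1, s - s ^ 2 * R)).2
  set F' := (transfer (-s ^ 2) L ((0 : ℂ), (1 : ℂ))).1
  set G' := (transfer (-s ^ 2) L ((0 : ℂ), (1 : ℂ))).2
  simp only [mul_one, mul_zero, sub_zero] at h3
  linear_combination (s * F' + G') * h1 - (s * F + G) * h2 - (s * f 0 + d) * h3

end IndefString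

/-! ### Partitions of strings in F₀ and the value of the right-hand side. -/

lemma measure_union_of_null_left {α : Type*} [MeasurableSpace α] {μ : Measure α} {s t : Set α}
    (h : μ s = 0) : μ (s ∪ t) = μ t :=
  le_antisymm ((measure_union_le s t).trans (by rw [h, zero_add])) (measure_mono subset_union_right)

namespace IndefString

variable {S : GenString}

lemma GenString.MemF0.exists_finset {R : ℝ} (hS : S.MemF0 R) : ∃ F : Finset ℝ,
    ∀ x y : ℝ, 0 ≤ x → x < y → y ≤ R → (∀ t ∈ F, t ∉ Ioo x y) →
      (∃ c : ℝ, ∀ᵐ t ∂volume.restrict (Ioo x y), S.w t = c) ∧ S.υ (Ioo x y) = 0 := by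
  obtain ⟨n, t, c, -, h0, hR, hc⟩ := hS.w_piecewise
  refine ⟨Finset.univ.image t ∪ hS.υ_support.toFinset, fun x y hx hxy hy hF => ⟨?_, ?_⟩⟩
  · obtain ⟨j, hj1, hj2⟩ : ∃ j : Fin n, t j.castSucc ≤ x ∧ x < t j.succ := by
      by_contra! hcon
      have : ∀ i, t i ≤ x := fun i => Fin.induction (by rw [h0]; exact hx) hcon i
      linarith [this (Fin.last n)]
    have hj3 : y ≤ t j.succ := by
      by_contra! hlt
      exact hF (t j.succ) (Finset.mem_union_left _ (Finset.mem_image_of_mem t (Finset.mem_univ _)))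
        ⟨hj2, hlt⟩
    exact ⟨c j, ae_restrict_of_ae_restrict_of_subset (Ioo_subset_Ioo hj1 hj3) (hc j)⟩
  · refine measure_mono_null (t := S.υ.supportᶜ) (fun u hu hu' => ?_)
      Measure.measure_compl_support
    exact hF u (Finset.mem_union_right _ (hS.υ_support.mem_toFinset.mpr hu')) hu

lemma GenString.IsPartition.cons_of_lt {R x y c : ℝ} {L : List (ℝ × ℝ × ℝ)} (hxy : x < y)
    (hw : ∀ᵐ t ∂volume.restrict (Ioo x y), S.w t = c) (hυ : S.υ (Ioo x y) = 0)
    (hL : S.IsPartition R y L) : S.IsPartition R x ((y - x, c, S.υ.real {x}) :: L) := by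
  have h : x + (y - x) = y := by ring
  exact .cons (by linarith) (by rwa [h]) (by rwa [h]) (by rwa [h])

/-- Strong induction on the number of exceptional points in (x, R): cut at the first one. -/
lemma GenString.MemF0.exists_isPartition {R : ℝ} (hS : S.MemF0 R) :
    ∃ L, S.IsPartition R 0 L := by
  obtain ⟨F, hF⟩ := hS.exists_finset
  have key : ∀ (n : ℕ) (x : ℝ), 0 ≤ x → x ≤ R → (F.filter fun t => x < t ∧ t < R).card = n →
      ∃ L, S.IsPartition R x L := by
    intro n
    induction n using Nat.strong_induction_on with
    | _ n ih =>
      intro x hx hxR hn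
      rcases hxR.eq_or_lt with rfl | hlt
      · exact ⟨[], .nil⟩
      rcases (F.filter fun t => x < t ∧ t < R).eq_empty_or_nonempty with he | hne
      · obtain ⟨⟨c, hc⟩, hυ⟩ := hF x R hx hlt le_rfl fun t ht ht' => by
          have : t ∈ F.filter fun t => x < t ∧ t < R := Finset.mem_filter.mpr ⟨ht, ht'⟩
          rw [he] at this
          exact absurd this (Finset.notMem_empty t)
        exact ⟨_, .cons_of_lt hlt hc hυ .nil⟩
      · set y := (F.filter fun t => x < t ∧ t < R).min' hne with hy
        have hyF := Finset.min'_mem _ hne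
        rw [← hy, Finset.mem_filter] at hyF
        obtain ⟨⟨c, hc⟩, hυ⟩ := hF x y hx hyF.2.1 hyF.2.2.le fun t ht ht' => by
          have : t ∈ F.filter fun t => x < t ∧ t < R :=
            Finset.mem_filter.mpr ⟨ht, ht'.1, ht'.2.trans hyF.2.2⟩
          exact absurd ht'.2 (not_lt.mpr (Finset.min'_le _ t this))
        have hlt' : (F.filter fun t => y < t ∧ t < R).card < n := by
          rw [← hn]
          refine Finset.card_lt_card ⟨fun t ht => ?_, fun hsub => ?_⟩
          · rw [Finset.mem_filter] at ht ⊢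
            exact ⟨ht.1, hyF.2.1.trans ht.2.1, ht.2.2⟩
          · have := hsub (Finset.mem_filter.mpr hyF)
            exact lt_irrefl _ (Finset.mem_filter.mp this).2.1
        obtain ⟨L, hL⟩ := ih _ hlt' y (by linarith [hyF.2.1]) hyF.2.2.le rfl
        exact ⟨_, .cons_of_lt hyF.2.1 hc hυ hL⟩
  exact key _ 0 le_rfl hS.R_pos.le rfl

lemma GenString.measure_Ico_lt_top (x y : ℝ) : S.υ (Ico x y) < ⊤ :=
  (measure_mono Ico_subset_Icc_self).trans_lt isCompact_Icc.measure_lt_top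

lemma GenString.IsPartition.weight_eq {R x : ℝ} {L : List (ℝ × ℝ × ℝ)} (hL : S.IsPartition R x L) :
    IntegrableOn (fun t => |S.w t - t| ^ 2) (Ioo x R) ∧
      (∫ t in Ioo x R, |S.w t - t| ^ 2) + S.υ.real (Ico x R) = weight x L := by
  induction hL with
  | nil => simp [weight]
  | @cons x l c L hl hw hυ hL ih =>
    obtain ⟨ih1, ih2⟩ := ih
    set y := x + l with hy
    have hxy : x < y := by linarith
    have hyR : y ≤ R := hL.le
    have hae : (fun t => |S.w t - t| ^ 2) =ᵐ[volume.restrict (Ioo x y)] fun t => (c - t) ^ 2 := by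
      filter_upwards [hw] with t ht
      rw [ht, sq_abs]
    have hcint : IntegrableOn (fun t : ℝ => (c - t) ^ 2) (Ioo x y) :=
      ((Continuous.continuousOn (by fun_prop)).integrableOn_Icc).mono_set Ioo_subset_Icc_self
    have hint : IntegrableOn (fun t => |S.w t - t| ^ 2) (Ioo x y) := hcint.congr_fun_ae hae.symm
    have hint' : IntegrableOn (fun t => |S.w t - t| ^ 2) (Ico y R) := by
      rwa [integrableOn_Ico_iff_integrableOn_Ioo]
    have hval : ∫ t in Ioo x y, |S.w t - t| ^ 2 = ((c - x) ^ 3 - (c - x - l) ^ 3) / 3 := by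
      rw [integral_congr_ae hae, ← integral_Ioc_eq_integral_Ioo,
        ← intervalIntegral.integral_of_le hxy.le,
        intervalIntegral.integral_comp_sub_left (fun t => t ^ 2) c, integral_pow, hy]
      push_cast; ring
    have hmass : S.υ.real (Ico x y) = S.υ.real {x} := by
      rw [← Ioo_union_left hxy, measureReal_def, measureReal_def,
        measure_union_of_null_left hυ]
    refine ⟨?_, ?_⟩
    · rw [← Ioo_union_Ico_eq_Ioo hxy hyR]
      exact hint.union hint'
    · rw [← Ioo_union_Ico_eq_Ioo hxy hyR, ← Ico_union_Ico_eq_Ico hxy.le hyR,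
        setIntegral_union (disjoint_left.mpr fun t ht ht' => absurd ht.2 (not_lt.mpr ht'.1))
          measurableSet_Ico hint hint',
        measureReal_union (disjoint_left.mpr fun t ht ht' => absurd ht.2 (not_lt.mpr ht'.1))
          measurableSet_Ico (S.measure_Ico_lt_top _ _).ne (S.measure_Ico_lt_top _ _).ne,
        integral_Ico_eq_integral_Ioo, hval, hmass, weight, ← ih2]
      ring

lemma GenString.MemF0.trace_eq_weight {R : ℝ} (hS : S.MemF0 R) {L : List (ℝ × ℝ × ℝ)}
    (hL : S.IsPartition R 0 L) :
    IntegrableOn (fun t => |S.w t - t| ^ 2) (Ioi 0) ∧ S.υ (Ici 0) < ⊤ ∧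
      (∫ t in Ioi (0 : ℝ), |S.w t - t| ^ 2) + S.υ.real (Ici 0) = weight 0 L := by
  obtain ⟨h1, h2⟩ := hL.weight_eq
  have hR := hS.R_pos
  have hz : (fun t => |S.w t - t| ^ 2) =ᵐ[volume.restrict (Ici R)] fun _ => 0 := by
    filter_upwards [hS.w_eq] with t ht
    simp [ht]
  have hz' : IntegrableOn (fun t => |S.w t - t| ^ 2) (Ici R) :=
    (integrableOn_zero).congr_fun_ae hz.symm
  have hm : S.υ (Ici 0) = S.υ (Ico 0 R) := by
    rw [← Ico_union_Ici_eq_Ici hR.le, union_comm, measure_union_of_null_left hS.υ_eq]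
  refine ⟨?_, ?_, ?_⟩
  · rw [← Ioo_union_Ici_eq_Ioi hR]
    exact h1.union hz'
  · rw [hm]; exact S.measure_Ico_lt_top _ _
  · rw [measureReal_def, hm, ← measureReal_def, ← Ioo_union_Ici_eq_Ioi hR,
      setIntegral_union (show Disjoint (Ioo 0 R) (Ici R) from
        disjoint_left.mpr fun t ht ht' => absurd ht.2 (not_lt.mpr ht'))
        measurableSet_Ici h1 hz', integral_congr_ae hz, integral_zero, add_zero, h2]

end IndefString

/-! ### Zeros and logarithmic integrals of products of linear factors. -/

lemma integrable_of_integrableOn_Ioi_of_even {f : ℝ → ℝ} (hf : IntegrableOn f (Ioi 0))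
    (heven : ∀ x, f (-x) = f x) : Integrable f := by
  have int_Iic : IntegrableOn f (Iic 0) := by
    rw [← Measure.map_neg_eq_self (volume : Measure ℝ)]
    let m : MeasurableEmbedding fun x : ℝ => -x := (Homeomorph.neg ℝ).measurableEmbedding
    rw [m.integrableOn_map_iff]
    simp_rw [Function.comp_def, heven, neg_preimage, neg_Iic, neg_zero]
    rwa [integrableOn_Ici_iff_integrableOn_Ioi]
  rw [← integrableOn_univ, ← Iic_union_Ioi (a := (0 : ℝ))]
  exact int_Iic.union hf

lemma integral_eq_two_mul_integral_Ioi_of_even {f : ℝ → ℝ} (heven : ∀ x, f (-x) = f x) :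
    ∫ x, f x = 2 * ∫ x in Ioi (0 : ℝ), f x := by
  rw [← integral_comp_abs]
  refine integral_congr_ae (Filter.Eventually.of_forall fun x => ?_)
  rcases abs_choice x with h | h <;> simp only [h, heven]

lemma Multiset.exists_fin_enumeration {α : Type*} (M : Multiset α) :
    ∃ (N : ℕ) (ρ : Fin N → α), Finset.univ.val.map ρ = M := by
  induction M using Quotient.inductionOn with
  | _ l => exact ⟨l.length, fun i => l[i.1], by simp⟩

lemma analyticAt_prod_one_sub (M : Multiset ℂ) (k₀ : ℂ) :
    AnalyticAt ℂ (fun k : ℂ => (M.map fun ρ => 1 - ρ * (Complex.I * k)).prod) k₀ := by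
  induction M using Multiset.induction with
  | empty => simpa using analyticAt_const
  | cons σ M ih =>
    simp only [Multiset.map_cons, Multiset.prod_cons]
    exact AnalyticAt.fun_mul (by fun_prop) ih

lemma analyticOrderAt_prod_one_sub (M : Multiset ℂ) (k₀ : ℂ) :
    analyticOrderAt (fun k : ℂ => (M.map fun ρ => 1 - ρ * (Complex.I * k)).prod) k₀ =
      ((M.filter fun ρ => ρ * (Complex.I * k₀) = 1).card : ℕ∞) := by
  induction M using Multiset.induction with
  | empty =>
    simp only [Multiset.map_zero, Multiset.prod_zero, Multiset.filter_zero, Multiset.card_zero,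
      Nat.cast_zero]
    exact analyticOrderAt_eq_zero.mpr (Or.inr one_ne_zero)
  | cons ρ M ih =>
    have hfac : AnalyticAt ℂ (fun k : ℂ => 1 - ρ * (Complex.I * k)) k₀ := by fun_prop
    have hprod : AnalyticAt ℂ (fun k : ℂ => (M.map fun ρ => 1 - ρ * (Complex.I * k)).prod) k₀ :=
      analyticAt_prod_one_sub M k₀
    have hmul : (fun k : ℂ => ((ρ ::ₘ M).map fun ρ => 1 - ρ * (Complex.I * k)).prod) =
        (fun k : ℂ => 1 - ρ * (Complex.I * k)) *
          fun k : ℂ => (M.map fun ρ => 1 - ρ * (Complex.I * k)).prod := by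
      ext k; simp
    rw [hmul, analyticOrderAt_mul hfac hprod, ih]
    by_cases h : ρ * (Complex.I * k₀) = 1
    · rw [Multiset.filter_cons_of_pos (p := fun ρ : ℂ => ρ * (Complex.I * k₀) = 1) M h,
        Multiset.card_cons]
      have hlin : (fun k : ℂ => 1 - ρ * (Complex.I * k)) =
          (fun _ => -(ρ * Complex.I)) * fun k => k - k₀ := by
        ext k
        simp only [Pi.mul_apply]
        linear_combination -h
      have hne : -(ρ * Complex.I) ≠ 0 := by
        intro h0
        have : ρ * (Complex.I * k₀) = 0 := by linear_combination -k₀ * h0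
        rw [h] at this
        exact one_ne_zero this
      have hconst : analyticOrderAt (fun _ : ℂ => -(ρ * Complex.I)) k₀ = 0 :=
        analyticOrderAt_eq_zero.mpr (Or.inr hne)
      rw [hlin, analyticOrderAt_mul analyticAt_const (by fun_prop),
        analyticOrderAt_id_sub_const_self, hconst]
      push_cast
      ring
    · have hzero : analyticOrderAt (fun k : ℂ => 1 - ρ * (Complex.I * k)) k₀ = 0 :=
        analyticOrderAt_eq_zero.mpr (Or.inr (sub_ne_zero.mpr (Ne.symm h)))
      rw [Multiset.filter_cons_of_neg (p := fun ρ : ℂ => ρ * (Complex.I * k₀) = 1) M h, hzero,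
        zero_add]

lemma log_norm_multiset_prod {α : Type*} (M : Multiset α) (f : α → ℂ) (hf : ∀ x ∈ M, f x ≠ 0) :
    Real.log ‖(M.map f).prod‖ = (M.map fun x => Real.log ‖f x‖).sum := by
  induction M using Multiset.induction with
  | empty => simp
  | cons x M ih =>
    have h1 := hf x (Multiset.mem_cons_self x M)
    have h2 : ∀ y ∈ M, f y ≠ 0 := fun y hy => hf y (Multiset.mem_cons_of_mem hy)
    have h3 : (M.map f).prod ≠ 0 := Multiset.prod_ne_zero fun h0 => by
      obtain ⟨y, hy, hy0⟩ := Multiset.mem_map.mp h0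
      exact h2 y hy hy0
    rw [Multiset.map_cons, Multiset.prod_cons, norm_mul,
      Real.log_mul (norm_ne_zero_iff.mpr h1) (norm_ne_zero_iff.mpr h3), ih h2, Multiset.map_cons,
      Multiset.sum_cons]

lemma integral_multiset_sum {α X : Type*} [MeasurableSpace X] {μ : Measure X} (M : Multiset α)
    (f : α → X → ℝ) (hf : ∀ x ∈ M, Integrable (f x) μ) :
    Integrable (fun t => (M.map fun x => f x t).sum) μ ∧
      ∫ t, (M.map fun x => f x t).sum ∂μ = (M.map fun x => ∫ t, f x t ∂μ).sum := by
  induction M using Multiset.induction with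
  | empty => simp
  | cons x M ih =>
    have h1 := hf x (Multiset.mem_cons_self x M)
    obtain ⟨i1, i2⟩ := ih fun y hy => hf y (Multiset.mem_cons_of_mem hy)
    simp only [Multiset.map_cons, Multiset.sum_cons]
    exact ⟨h1.add i1, by rw [integral_add h1 i1, i2]⟩

lemma re_multiset_sum (M : Multiset ℂ) : M.sum.re = (M.map Complex.re).sum :=
  map_multiset_sum Complex.reAddGroupHom M

/-- The trace formula for a product of linear factors `1 - ρ i t`. -/
lemma integral_log_norm_prod (M : Multiset ℂ) (hM : ∀ ρ ∈ M, ρ.re ≠ 0)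
    (hsq : (M.map (· ^ 2)).sum = 0) {g : ℝ → ℝ} (heven : ∀ t, g (-t) = g t)
    (hg : ∀ t : ℝ, g t = Real.log ‖(M.map fun ρ => 1 - ρ * (Complex.I * t)).prod‖) :
    Integrable (fun t : ℝ => 1 / t ^ 4 * g t) ∧
      ∫ t : ℝ, 1 / t ^ 4 * g t = -(Real.pi / 3) * (((M.map (· ^ 3)).sum).re
        - 2 * ((M.filter fun ρ => ρ.re < 0).map fun ρ => (ρ ^ 3).re).sum) := by
  have hne : ∀ ρ ∈ M, ∀ t : ℝ, 1 - ρ * (Complex.I * t) ≠ 0 := by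
    intro ρ hρ t h0
    have hre := congrArg Complex.re h0
    have him := congrArg Complex.im h0
    simp at hre him
    rcases him with him | him
    · exact hM ρ hρ him
    · simp [him] at hre
  -- Evenness pairs t with -t, and (1 - iρt)(1 + iρt) = 1 + ρ²t².
  have hdouble : ∀ t : ℝ, 2 * g t = (M.map fun ρ => Real.log ‖1 + ρ ^ 2 * (t : ℂ) ^ 2‖).sum := by
    intro t
    have h1 : 2 * g t = g t + g (-t) := by rw [heven]; ring
    rw [h1, hg, hg, log_norm_multiset_prod M _ fun ρ hρ => hne ρ hρ t,
      log_norm_multiset_prod M _ fun ρ hρ => hne ρ hρ (-t), ← Multiset.sum_map_add]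
    congr 1
    refine Multiset.map_congr rfl fun ρ hρ => ?_
    rw [← Real.log_mul (norm_ne_zero_iff.mpr (hne ρ hρ t)) (norm_ne_zero_iff.mpr (hne ρ hρ (-t))),
      ← norm_mul]
    congr 2
    push_cast
    linear_combination (-(ρ ^ 2 * (t : ℂ) ^ 2)) * Complex.I_sq
  have hsq' : (M.map fun ρ => (ρ ^ 2).re).sum = 0 := by
    have := congrArg Complex.re hsq
    rwa [re_multiset_sum, Multiset.map_map] at this
  -- Subtracting (Re ρ²)t² in each factor costs nothing because these terms sum to zero, yet it
  -- makes each factor integrable separately.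
  have hsum : ∀ t : ℝ, 1 / t ^ 4 * g t = 1 / 2 *
      (M.map fun ρ => (Real.log ‖1 + ρ ^ 2 * (t : ℂ) ^ 2‖ - (ρ ^ 2).re * t ^ 2) / t ^ 4).sum := by
    intro t
    rw [Multiset.sum_map_div, Multiset.sum_map_sub, Multiset.sum_map_mul_right, hsq', ← hdouble]
    ring
  obtain ⟨i1, i2⟩ := integral_multiset_sum (μ := volume.restrict (Ioi (0 : ℝ))) M
    (fun ρ t => (Real.log ‖1 + ρ ^ 2 * (t : ℂ) ^ 2‖ - (ρ ^ 2).re * t ^ 2) / t ^ 4)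
    (fun ρ hρ => (integral_log_norm_one_add_mul_sq (hM ρ hρ)).1)
  have hevenI : ∀ t : ℝ, 1 / (-t) ^ 4 * g (-t) = 1 / t ^ 4 * g t := by
    intro t; rw [heven, (by decide : Even 4).neg_pow]
  refine ⟨integrable_of_integrableOn_Ioi_of_even ?_ hevenI, ?_⟩
  · simp only [hsum]
    exact i1.const_mul _
  · rw [integral_eq_two_mul_integral_Ioi_of_even hevenI]
    simp only [hsum]
    rw [integral_const_mul, i2, re_multiset_sum, Multiset.map_map]
    have hval : (M.map fun ρ => ∫ t in Ioi (0 : ℝ),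
        (Real.log ‖1 + ρ ^ 2 * (t : ℂ) ^ 2‖ - (ρ ^ 2).re * t ^ 2) / t ^ 4) =
        M.map fun ρ => -(Real.pi / 3) * ((ρ ^ 3).re - if ρ.re < 0 then 2 * (ρ ^ 3).re else 0) := by
      refine Multiset.map_congr rfl fun ρ hρ => ?_
      rw [(integral_log_norm_one_add_mul_sq (hM ρ hρ)).2]
      rcases lt_or_gt_of_ne (hM ρ hρ) with h | h
      · rw [if_neg (not_lt.mpr h.le), if_pos h]; ring
      · rw [if_pos h, if_neg (not_lt.mpr h.le)]; ring
    rw [hval, Multiset.sum_map_mul_left, Multiset.sum_map_sub]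
    have hfilter : (M.map fun ρ => if ρ.re < 0 then 2 * (ρ ^ 3).re else 0).sum =
        2 * ((M.filter fun ρ => ρ.re < 0).map fun ρ => (ρ ^ 3).re).sum := by
      clear hval i1 i2 hsum hsq' hdouble hne hg hsq hM
      induction M using Multiset.induction with
      | empty => simp
      | cons ρ M ih =>
        rw [Multiset.map_cons, Multiset.sum_cons, ih]
        by_cases h : ρ.re < 0
        · rw [if_pos h, Multiset.filter_cons_of_pos (p := fun ρ : ℂ => ρ.re < 0) M h,
            Multiset.map_cons, Multiset.sum_cons]
          ring
        · rw [if_neg h, Multiset.filter_cons_of_neg (p := fun ρ : ℂ => ρ.re < 0) M h, zero_add]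
    rw [hfilter]
    simp only [Function.comp_def]
    ring

/-! ### The reciprocal transmission coefficient as an exponential times a polynomial. -/

namespace IndefString

/-- The identity theorem: the Jost solutions fix the values on the open upper half-plane. -/
lemma isReciprocalTransmission_unique {S : GenString} {R : ℝ} {a b : ℂ → ℂ}
    (ha : S.IsReciprocalTransmission R a) (hb : S.IsReciprocalTransmission R b) : a = b := by
  have h1 : AnalyticOnNhd ℂ a univ := fun x _ => ha.1.analyticAt x
  have h2 : AnalyticOnNhd ℂ b univ := fun x _ => hb.1.analyticAt x
  refine h1.eq_of_eventuallyEq h2 (z₀ := Complex.I) ?_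
  have hopen : IsOpen {k : ℂ | 0 < k.im} := isOpen_lt continuous_const Complex.continuous_im
  filter_upwards [hopen.mem_nhds (show (0 : ℝ) < Complex.I.im by simp)] with k hk
  obtain ⟨f, d, hf⟩ := (ha.2 k hk).1
  rw [(ha.2 k hk).2 f d hf, (hb.2 k hk).2 f d hf]

open Polynomial in
lemma aeval_transmission {R : ℝ} {L : List (ℝ × ℝ × ℝ)} {p : ℝ[X]}
    (hp : X * (transfer (-X ^ 2 : ℝ[X]) L (1, X - X ^ 2 * C R)).1 +
        (transfer (-X ^ 2 : ℝ[X]) L (1, X - X ^ 2 * C R)).2 = C 2 * X * p) (s : ℂ) :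
    s * (transfer (-s ^ 2) L (1, s - s ^ 2 * R)).1 + (transfer (-s ^ 2) L (1, s - s ^ 2 * R)).2 =
      2 * s * aeval s p := by
  have h := map_transfer (aeval s : ℝ[X] →ₐ[ℝ] ℂ) (-X ^ 2) L (1, X - X ^ 2 * C R)
  simp only [map_neg, map_pow, aeval_X, map_one, map_sub, map_mul, aeval_C] at h
  have h' := congrArg (aeval s : ℝ[X] →ₐ[ℝ] ℂ) hp
  simp only [map_add, map_mul, aeval_X, aeval_C] at h'
  simp only [Complex.coe_algebraMap] at h h'
  rw [h]
  simpa using h'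

open Polynomial in
lemma isReciprocalTransmission_of_polynomial {S : GenString} {R : ℝ} (hS : S.MemF0 R)
    {L : List (ℝ × ℝ × ℝ)} (hL : S.IsPartition R 0 L) {p : ℝ[X]}
    (hp : X * (transfer (-X ^ 2 : ℝ[X]) L (1, X - X ^ 2 * C R)).1 +
        (transfer (-X ^ 2 : ℝ[X]) L (1, X - X ^ 2 * C R)).2 = C 2 * X * p) :
    S.IsReciprocalTransmission R
      fun k => Complex.exp (Complex.I * k * R) * aeval (Complex.I * k) p := by
  refine ⟨?_, fun k hk => ⟨GenString.exists_isJost hS hL k, fun f d hf => ?_⟩⟩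
  · have : Differentiable ℂ fun z : ℂ => aeval z p := Polynomial.differentiable_aeval p
    exact Differentiable.mul (by fun_prop) (this.comp (by fun_prop))
  · have hk0 : k ≠ 0 := fun h => by simp [h] at hk
    rw [hf.eq hS hL rfl, aeval_transmission hp]
    field_simp [Complex.I_ne_zero]

open Polynomial in
lemma coeff_cubic_add {a₀ a₁ a₂ a₃ b₀ b₁ b₂ b₃ : ℂ} {q r : ℂ[X]}
    (h : C a₀ + C a₁ * X + C a₂ * X ^ 2 + C a₃ * X ^ 3 + X ^ 4 * q =
      C b₀ + C b₁ * X + C b₂ * X ^ 2 + C b₃ * X ^ 3 + X ^ 4 * r) : a₁ = b₁ ∧ a₂ = b₂ ∧ a₃ = b₃ := by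
  have key : ∀ n, _ := fun n => congrArg (fun f => coeff f n) h
  refine ⟨?_, ?_, ?_⟩
  · simpa [coeff_C, coeff_X, coeff_X_pow_mul'] using key 1
  · simpa [coeff_C, coeff_X, coeff_X_pow_mul'] using key 2
  · simpa [coeff_C, coeff_X, coeff_X_pow_mul'] using key 3

open Polynomial in
lemma power_sums_of_expansion {R W : ℝ} {p q : ℝ[X]} {M : Multiset ℂ}
    (hpq : p = 1 - C R * X + C (R ^ 2 / 2) * X ^ 2 + C (W / 2 - R ^ 3 / 6) * X ^ 3 + X ^ 4 * q)
    (hpM : p.map (algebraMap ℝ ℂ) = (M.map fun ρ => 1 - C ρ * X).prod) :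
    (M.map (· ^ 2)).sum = 0 ∧ (M.map (· ^ 3)).sum = ((-(3 / 2 * W) : ℝ) : ℂ) := by
  obtain ⟨r, hr⟩ := prod_one_sub_expansion M
  have hl : C 6 * p.map (algebraMap ℝ ℂ) = C 6 + C (-(6 * (R : ℂ))) * X
      + C (6 * ((R ^ 2 / 2 : ℝ) : ℂ)) * X ^ 2 + C (6 * ((W / 2 - R ^ 3 / 6 : ℝ) : ℂ)) * X ^ 3
      + X ^ 4 * (C 6 * q.map (algebraMap ℝ ℂ)) := by
    rw [hpq]
    simp only [Polynomial.map_add, Polynomial.map_sub, Polynomial.map_mul, Polynomial.map_pow,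
      map_C, map_X, Polynomial.map_one, C_mul, C_neg, Complex.coe_algebraMap]
    ring
  have hr' : C 6 * p.map (algebraMap ℝ ℂ) = C 6 + C (-(6 * M.sum)) * X
      + C (3 * (M.sum ^ 2 - (M.map (· ^ 2)).sum)) * X ^ 2
      + C (-(M.sum ^ 3 - 3 * M.sum * (M.map (· ^ 2)).sum + 2 * (M.map (· ^ 3)).sum)) * X ^ 3
      + X ^ 4 * r := by
    rw [hpM, hr]
    simp only [C_neg]
    ring
  obtain ⟨c1, c2, c3⟩ := coeff_cubic_add (hl.symm.trans hr')
  push_cast at c2 c3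
  have h1 : M.sum = R := by linear_combination c1 / 6
  rw [h1] at c2 c3
  have h2 : (M.map (· ^ 2)).sum = 0 := by linear_combination c2 / 3
  rw [h2] at c3
  refine ⟨h2, ?_⟩
  push_cast
  linear_combination c3 / 2

end IndefString

namespace IndefString

open Polynomial in
lemma aeval_eq_prod {p : ℝ[X]} {M : Multiset ℂ}
    (hpM : p.map (algebraMap ℝ ℂ) = (M.map fun ρ => 1 - C ρ * X).prod) (s : ℂ) :
    aeval s p = (M.map fun ρ => 1 - ρ * s).prod := by
  rw [aeval_def, eval₂_eq_eval_map, hpM, eval_multiset_prod, Multiset.map_map]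
  simp

/-- The exponential has no zeros, and each factor vanishing at k contributes a simple zero. In the
upper half-plane only factors with Re ρ < 0 vanish, and for these ρ = -1/κ. -/
lemma exists_isZeroEnumeration {M : Multiset ℂ} {R : ℝ} {a : ℂ → ℂ} (hM : ∀ ρ ∈ M, ρ ≠ 0)
    (hre : ∀ ρ ∈ M, ρ.re < 0 → ρ.im = 0)
    (ha : ∀ k, a k = Complex.exp (Complex.I * k * R) *
      (M.map fun ρ => 1 - ρ * (Complex.I * k)).prod) :
    ∃ (N : ℕ) (κ : Fin N → ℝ), IsZeroEnumeration a κ ∧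
      ∑ n, 1 / κ n ^ 3 = -((M.filter fun ρ => ρ.re < 0).map fun ρ => (ρ ^ 3).re).sum := by
  obtain ⟨N, ρ, hρ⟩ := (M.filter fun ρ => ρ.re < 0).exists_fin_enumeration
  have hmem : ∀ n, ρ n ∈ M ∧ (ρ n).re < 0 := fun n => by
    rw [← Multiset.mem_filter (p := fun ρ : ℂ => ρ.re < 0), ← hρ]
    exact Multiset.mem_map_of_mem ρ (Finset.mem_univ n)
  have hreal : ∀ n, ρ n = ((ρ n).re : ℂ) := fun n =>
    Complex.ext rfl (by simpa using hre _ (hmem n).1 (hmem n).2)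
  refine ⟨N, fun n => -(ρ n).re⁻¹, ⟨fun n => neg_pos.mpr (inv_lt_zero.mpr (hmem n).2), ?_⟩, ?_⟩
  · intro k hk
    have hexp : AnalyticAt ℂ (fun k : ℂ => Complex.exp (Complex.I * k * R)) k := by fun_prop
    have hprod : AnalyticAt ℂ (fun k : ℂ => (M.map fun ρ => 1 - ρ * (Complex.I * k)).prod) k :=
      analyticAt_prod_one_sub M k
    have ha' : a = (fun k : ℂ => Complex.exp (Complex.I * k * R)) *
        fun k : ℂ => (M.map fun ρ => 1 - ρ * (Complex.I * k)).prod := funext ha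
    have hexp0 : analyticOrderAt (fun k : ℂ => Complex.exp (Complex.I * k * R)) k = 0 :=
      analyticOrderAt_eq_zero.mpr (Or.inr (Complex.exp_ne_zero _))
    rw [ha', analyticOrderAt_mul hexp hprod, hexp0, zero_add, analyticOrderAt_prod_one_sub]
    have hset : {n : Fin N | Complex.I * ((-(ρ n).re⁻¹ : ℝ) : ℂ) = k} =
        ((Finset.univ.filter fun n => ρ n * (Complex.I * k) = 1 : Finset (Fin N)) : Set (Fin N)) := by
      ext n
      have h0 : ((ρ n).re : ℂ) ≠ 0 := by exact_mod_cast (hmem n).2.ne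
      rw [Finset.coe_filter, mem_ofPred_eq, mem_ofPred_eq, hreal n]
      simp only [Finset.mem_univ, true_and, Complex.ofReal_re]
      constructor
      · rintro rfl
        push_cast
        field_simp
        linear_combination -Complex.I_sq
      · intro h
        push_cast
        field_simp
        linear_combination Complex.I * h - ((ρ n).re : ℂ) * k * Complex.I_sq
    rw [hset, Set.encard_coe_eq_coe_finsetCard]
    congr 1
    have h1 : (Finset.univ.filter fun n => ρ n * (Complex.I * k) = 1).card =
        ((M.filter fun ρ => ρ.re < 0).filter fun ρ => ρ * (Complex.I * k) = 1).card := by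
      rw [← hρ, Multiset.filter_map, Multiset.card_map]
      rfl
    rw [h1, Multiset.filter_filter]
    congr 1
    refine Multiset.filter_congr fun σ hσ => ?_
    constructor
    · intro h
      refine ⟨h, ?_⟩
      -- From ik = 1/σ it follows that Re σ = -|σ|² Im k < 0.
      have hσ0 : 0 < Complex.normSq σ := Complex.normSq_pos.mpr (hM σ hσ)
      have hk0 : Complex.I * k * (Complex.normSq σ : ℂ) = (starRingEnd ℂ) σ := by
        rw [Complex.normSq_eq_conj_mul_self]
        linear_combination (starRingEnd ℂ σ) * h
      have := congrArg Complex.re hk0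
      rw [Complex.re_mul_ofReal, Complex.conj_re, Complex.I_mul_re] at this
      nlinarith
    · exact fun h => h.1
  · rw [← hρ, Multiset.map_map]
    change _ = -∑ n, (ρ n ^ 3).re
    rw [← Finset.sum_neg_distrib]
    refine Finset.sum_congr rfl fun n _ => ?_
    have : (ρ n ^ 3).re = (ρ n).re ^ 3 := by
      rw [hreal n, ← Complex.ofReal_pow, Complex.ofReal_re, Complex.ofReal_re]
    rw [this, (by decide : Odd 3).neg_pow, inv_pow, one_div, inv_neg, inv_inv]

end IndefString

/-! ### The trace formula. -/

open IndefString Polynomial in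
theorem lemma5p2 (S : IndefString.GenString) (R : ℝ) (hS : S.MemF0 R) :
    (∃! a : ℂ → ℂ, S.IsReciprocalTransmission R a) ∧
      ∀ a : ℂ → ℂ, S.IsReciprocalTransmission R a →
        ∃ (N : ℕ) (κ : Fin N → ℝ), IndefString.IsZeroEnumeration a κ ∧
          Integrable (fun k : ℝ => 1 / k ^ 4 * Real.log ‖a (k : ℂ)‖) ∧
          IntegrableOn (fun x : ℝ => |S.w x - x| ^ 2) (Ioi 0) ∧
          S.υ (Ici 0) < ⊤ ∧
          4 / 3 * ∑ n, 1 / κ n ^ 3 +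
              2 / Real.pi * ∫ k : ℝ, 1 / k ^ 4 * Real.log ‖a (k : ℂ)‖ =
            (∫ x in Ioi (0 : ℝ), |S.w x - x| ^ 2) + S.υ.real (Ici 0) := by
  obtain ⟨L, hL⟩ := hS.exists_isPartition
  obtain ⟨p, q, hp, hpq⟩ := exists_transmission_polynomial R L (by simpa using hL.add_sum)
  have ha₀ := isReciprocalTransmission_of_polynomial hS hL hp
  refine ⟨⟨_, ha₀, fun b hb => isReciprocalTransmission_unique hb ha₀⟩, fun a ha => ?_⟩
  have haa := isReciprocalTransmission_unique ha ha₀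
  obtain ⟨M, hM, hpM⟩ := exists_multiset_inv_roots (p.map (algebraMap ℝ ℂ)) (by
    rw [hpq]; simp)
  have hval : ∀ k, a k = Complex.exp (Complex.I * k * R) *
      (M.map fun ρ => 1 - ρ * (Complex.I * k)).prod := fun k => by
    rw [haa]; exact congrArg _ (aeval_eq_prod hpM _)
  -- Apply the energy argument at the root 1/ρ of p, whose real part has the same sign as that of ρ.
  have hroot : ∀ ρ ∈ M, ρ.re ≤ 0 → ρ.im = 0 ∧ ρ.re < 0 := by
    intro ρ hρ hle
    have hn : 0 < Complex.normSq ρ := Complex.normSq_pos.mpr (hM ρ hρ)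
    have hz : aeval ρ⁻¹ p = 0 := by
      rw [aeval_eq_prod hpM]
      refine Multiset.prod_eq_zero (Multiset.mem_map.mpr ⟨ρ, hρ, ?_⟩)
      rw [mul_inv_cancel₀ (hM ρ hρ), sub_self]
    obtain ⟨h1, h2⟩ := transfer_root (R := R) hL.pos (inv_ne_zero (hM ρ hρ)) (by
      rw [Complex.inv_re]; exact div_nonpos_of_nonpos_of_nonneg hle hn.le) (by
      rw [aeval_transmission hp, hz, mul_zero])
    rw [Complex.inv_im, div_eq_zero_iff, neg_eq_zero] at h1
    rw [Complex.inv_re] at h2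
    refine ⟨h1.resolve_right hn.ne', ?_⟩
    by_contra hcon
    exact absurd h2 (not_lt.mpr (div_nonneg (not_lt.mp hcon) hn.le))
  have hre : ∀ ρ ∈ M, ρ.re ≠ 0 := fun ρ hρ h0 => (hroot ρ hρ h0.le).2.ne h0
  have hnorm : ∀ t : ℝ, ‖a t‖ = ‖aeval (Complex.I * (t : ℂ)) p‖ := by
    intro t
    have : Complex.I * (t : ℂ) * R = ((t * R : ℝ) : ℂ) * Complex.I := by push_cast; ring
    rw [hval, norm_mul, this, Complex.norm_exp_ofReal_mul_I, one_mul, aeval_eq_prod hpM]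
  -- Since p has real coefficients, conjugating its argument it conjugates its value.
  have heven : ∀ t : ℝ, Real.log ‖a ((-t : ℝ) : ℂ)‖ = Real.log ‖a t‖ := by
    intro t
    have : Complex.I * ((-t : ℝ) : ℂ) = (starRingEnd ℂ) (Complex.I * (t : ℂ)) := by
      simp
    rw [hnorm, hnorm, this, aeval_conj, Complex.norm_conj]
  obtain ⟨hs2, hs3⟩ := power_sums_of_expansion hpq hpM
  obtain ⟨hint, hI⟩ := integral_log_norm_prod M hre hs2 (g := fun t => Real.log ‖a (t : ℂ)‖) heven
    fun t => by rw [hnorm, aeval_eq_prod hpM]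
  obtain ⟨N, κ, hκ, hsum⟩ := exists_isZeroEnumeration hM
    (fun ρ hρ h => (hroot ρ hρ h.le).1) hval
  obtain ⟨hw, hυ, htrace⟩ := hS.trace_eq_weight hL
  refine ⟨N, κ, hκ, hint, hw, hυ, ?_⟩
  rw [hI, htrace, hsum, hs3, Complex.ofReal_re]
  have := Real.pi_ne_zero
  field_simp
  ring
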